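/- Let $G$ be a directed acyclic graph on the nodes $[n]=\{1,\dots,n\}$ with edge set $E$. Write $\mathrm{pa}(i)$ for the parents of $i$ and $\mathrm{nd}(i)$ for the non-descendants of $i$ (the nodes other than $i$ that are not reachable from $i$ by a directed path). Let $\Sigma\cong\mathbb{C}^{\binom{n+1}{2}}$ be the affine space of complex symmetric $n\times n$ matrices $[\sigma_{ij}]$, and $\hat\Sigma\cong\mathbb{C}^{\binom n2}$ the subspace of those with $\sigma_{ii}=1$ for all $i$. Let $\mathrm{loc}(G)\subset\Sigma$ be the set of covariance matrices of (possibly singular) real Gaussian vectors $(X_1,\dots,X_n)$ such that $X_i\perp\!\!\!\perp X_{\mathrm{nd}(i)}\mid X_{\mathrm{pa}(i)}$ for every $i$. Let $$X_G=[\mathrm{loc}(G)]_Z\subset\Sigma,\qquad \hat X_G=[\mathrm{loc}(G)\cap\hat\Sigma]_Z\subset\hat\Sigma,$$ where $[\cdot]_Z$ denotes Zariski closure. Let $\hat I_G\subset\mathbb{C}[\hat\Sigma]$ be the ideal generated by the minors $|\hat\sigma_{iK,jK}|$ (rows $\{i\}\cup K$, columns $\{j\}\cup K$) of the generic matrix $[\hat\sigma_{ij}]$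 of $\hat\Sigma$, for all $i\in[n]$, $K=\mathrm{pa}(i)$ and $j\in\mathrm{nd}(i)\setminus\mathrm{pa}(i)$. Let $\hat\theta_0=\prod_{A\subset[n]}|\hat\Sigma_{AA}|\in\mathbb{C}[\hat\Sigma]$ be the product of all principal minors of this generic matrix. For an ideal $I$ let $V(I)$ be its zero set, and for a set $S$ let $I(S)$ be the ideal of polynomials vanishing on $S$. Then: (a) $\hat X_G$ is an affine rational irreducible variety of dimension $|E|$. It is also the Zariski closure of the set of positive definite matrices in $\mathrm{loc}(G)\cap\hat\Sigma$, and $\hat X_G=X_G\cap\hat\Sigma$. (b) There is a Zariski closed set $\hat B_G\subset\{\hat\theta_0=0\}$ in $\hat\Sigma$ such that $V(\hat I_G)=\hat X_G\cup\hat B_G$. (c) The ideal $I(\hat X_G)$ is prime and is the saturation of $\hat I_G$ at $\hat\theta_0$, that is, $I(\hat X_G)=\hat S^{-1}\hat I_G\cap\mathbb{C}[\hat\Sigma]$, where $\hat S$ is the set of powers of $\hat\theta_0$. (d) $\hat X_G$ is smooth at each of its points at which all principal minors are nonzero. -/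

import Mathlib

open MvPolynomial MeasureTheory ProbabilityTheory

noncomputable section

/-! ### Affine varieties over `ℂ` -/

namespace AffineVar

variable {ι : Type*}

/-- The Zariski closure of a set of points of the affine space `ℂ^ι`. -/
def zariskiClosure (S : Set (ι → ℂ)) : Set (ι → ℂ) :=
  zeroLocus ℂ (vanishingIdeal ℂ S)

/-- Zariski closed subsets of `ℂ^ι`: the common zero sets of families of polynomials. -/
def IsZariskiClosed (Z : Set (ι → ℂ)) : Prop :=
  ∃ I : Ideal (MvPolynomial ι ℂ), Z = zeroLocus ℂ I

/-- Affine irreducible varieties: nonempty Zariski closed sets that are not the union of two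
smaller Zariski closed sets. -/
def IsIrreducibleVariety (X : Set (ι → ℂ)) : Prop :=
  IsZariskiClosed X ∧ X.Nonempty ∧
    ∀ Z W : Set (ι → ℂ), IsZariskiClosed Z → IsZariskiClosed W → X ⊆ Z ∪ W → X ⊆ Z ∨ X ⊆ W

/-- The coordinate ring `ℂ[X] = ℂ[x] / I(X)`. -/
abbrev CoordRing (X : Set (ι → ℂ)) : Type _ :=
  MvPolynomial ι ℂ ⧸ vanishingIdeal ℂ X

/-- `X` has dimension `d`: its coordinate ring has Krull dimension `d`. -/
def HasDimension (X : Set (ι → ℂ)) (d : ℕ) : Prop :=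
  ringKrullDim (CoordRing X) = d

/-- `X` is birational to affine `d`-space: the total ring of fractions of its coordinate ring (its
function field, when `X` is irreducible) is isomorphic, over `ℂ`, to the field of rational functions
in `d` variables. -/
def IsBirationalToAffineSpace (X : Set (ι → ℂ)) (d : ℕ) : Prop :=
  Nonempty (FractionRing (CoordRing X) ≃ₐ[ℂ] FractionRing (MvPolynomial (Fin d) ℂ))

/-- Rational varieties: birational to an affine space. -/
def IsRational (X : Set (ι → ℂ)) : Prop :=
  ∃ d : ℕ, IsBirationalToAffineSpace X d

/-- Evaluation of regular functions at a point of `X`. -/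
def evalAt (X : Set (ι → ℂ)) (x : X) : CoordRing X →+* ℂ :=
  Ideal.Quotient.lift (vanishingIdeal ℂ X) (aeval (x : ι → ℂ) : MvPolynomial ι ℂ →ₐ[ℂ] ℂ).toRingHom
    (fun _ hp => hp x x.2)

/-- `X` is smooth over `ℂ` at its point `x`: the coordinate ring is smooth at the maximal ideal of
functions that vanish at `x`. -/
def IsSmoothAtPoint (X : Set (ι → ℂ)) (x : X) : Prop :=
  haveI : (RingHom.ker (evalAt X x)).IsPrime := RingHom.ker_isPrime (evalAt X x)
  Algebra.IsSmoothAt ℂ (RingHom.ker (evalAt X x))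

/-- The saturation `S⁻¹I ∩ R` of the ideal `I` of `R` at the powers of `θ`. -/
def saturation {R : Type*} [CommRing R] (I : Ideal R) (θ : R) : Ideal R :=
  (I.map (algebraMap R (Localization.Away θ))).comap (algebraMap R (Localization.Away θ))

end AffineVar

/-! ### Gaussian directed acyclic graphical models -/

namespace GaussianDAG

open AffineVar

variable {n : ℕ}

/-- No directed cycle (in particular no loop). -/
def IsAcyclic (G : Digraph (Fin n)) : Prop :=
  ∀ v, ¬ Relation.TransGen G.Adj v v

/-- The number of directed edges. -/
def numEdges (G : Digraph (Fin n)) : ℕ :=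
  Nat.card {e : Fin n × Fin n // G.Adj e.1 e.2}

open Classical in
/-- The parents of `i`. -/
def parents (G : Digraph (Fin n)) (i : Fin n) : Finset (Fin n) :=
  Finset.univ.filter fun j => G.Adj j i

open Classical in
/-- The non-descendants of `i`: the nodes other than `i` that no directed path from `i` reaches. -/
def nonDescendants (G : Digraph (Fin n)) (i : Fin n) : Finset (Fin n) :=
  Finset.univ.filter fun j => ¬ Relation.ReflTransGen G.Adj i j

/-- The imposed (local Markov) relations `X_i ⊥⊥ X_nd(i) | X_pa(i)` for a random vector with
law `μ`. -/
def IsCompatible (G : Digraph (Fin n)) (μ : Measure (Fin n → ℝ)) [IsFiniteMeasure μ] : Prop :=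
  ∀ i : Fin n,
    CondIndepFun
      (MeasurableSpace.comap (fun (x : Fin n → ℝ) (k : parents G i) => x k) inferInstance)
      (Measurable.comap_le (by fun_prop))
      (fun x : Fin n → ℝ => x i)
      (fun (x : Fin n → ℝ) (j : nonDescendants G i) => x j) μ

/-- Points of the affine space `Σ` of complex symmetric `n × n` matrices `[σ_ij]`, given by the
coordinates `σ_ij = σ_ji`. -/
abbrev SymPoint (n : ℕ) : Type := Sym2 (Fin n) → ℂ

/-- The off-diagonal positions, unordered. -/
abbrev OffDiag (n : ℕ) : Type := {e : Sym2 (Fin n) // ¬ e.IsDiag}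

/-- Points of the affine space of complex symmetric `n × n` matrices with ones on the diagonal,
given by their off-diagonal coordinates. -/
abbrev HatPoint (n : ℕ) : Type := OffDiag n → ℂ

/-- The symmetric matrix with given coordinates. -/
def symMatrix {R : Type*} (c : Sym2 (Fin n) → R) : Matrix (Fin n) (Fin n) R :=
  Matrix.of fun i j => c s(i, j)

/-- Coordinates of the symmetric matrix with ones on the diagonal and given off-diagonal
coordinates. -/
def unitDiag {R : Type*} [One R] (c : OffDiag n → R) : Sym2 (Fin n) → R :=
  fun e => if h : e.IsDiag then 1 else c ⟨e, h⟩

/-- The set of covariance matrices of (possibly singular) real Gaussian vectors that satisfy the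
imposed relations of `G`. -/
def loc (G : Digraph (Fin n)) : Set (SymPoint n) :=
  {σ | ∃ (μ : Measure (Fin n → ℝ)) (_ : IsProbabilityMeasure μ),
    IsGaussian μ ∧ IsCompatible G μ ∧
      ∀ i j, σ s(i, j) = (cov[fun x => x i, fun x => x j; μ] : ℝ)}

/-- The matrices with ones on the diagonal, as a subset of `Σ`. -/
def hatSigma (n : ℕ) : Set (SymPoint n) :=
  {σ | ∀ i, σ s(i, i) = 1}

/-- The part of `loc G` with ones on the diagonal, in off-diagonal coordinates. -/
def locHat (G : Digraph (Fin n)) : Set (HatPoint n) :=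
  {τ | unitDiag τ ∈ loc G}

open scoped ComplexOrder in
/-- The positive definite matrices with ones on the diagonal. -/
def hatPosDef (n : ℕ) : Set (HatPoint n) :=
  {τ | (symMatrix (unitDiag τ)).PosDef}

/-- `X_G`, the Zariski closure of `loc G` in the space of symmetric matrices. -/
def variety (G : Digraph (Fin n)) : Set (SymPoint n) :=
  zariskiClosure (loc G)

/-- The normalized variety of `G`, the Zariski closure of the part of `loc G` with ones on the
diagonal. -/
def varietyHat (G : Digraph (Fin n)) : Set (HatPoint n) :=
  zariskiClosure (locHat G)

/-- The principal minor `|M_AA|`. -/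
def principalMinor {R : Type*} [CommRing R] (M : Matrix (Fin n) (Fin n) R) (A : Finset (Fin n)) :
    R :=
  (M.submatrix (fun a : A => (a : Fin n)) (fun a : A => (a : Fin n))).det

/-- The minor `|M_{iK,jK}|` with rows `i, K` and columns `j, K`. -/
def ciMinor {R : Type*} [CommRing R] (M : Matrix (Fin n) (Fin n) R) (i j : Fin n)
    (K : Finset (Fin n)) : R :=
  (M.submatrix (fun o : Option K => o.elim i (fun k => (k : Fin n)))
    (fun o : Option K => o.elim j (fun k => (k : Fin n)))).det

/-- The generic symmetric matrix with ones on the diagonal. -/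
def genericHat (n : ℕ) : Matrix (Fin n) (Fin n) (MvPolynomial (OffDiag n) ℂ) :=
  symMatrix (unitDiag X)

/-- The ideal generated, in the polynomial ring on the off-diagonal coordinates, by the minors of
the imposed relations `i ⊥⊥ j | pa(i)`, for `j` a non-descendant of `i` and not a parent of `i`. -/
def idealHat (G : Digraph (Fin n)) : Ideal (MvPolynomial (OffDiag n) ℂ) :=
  Ideal.span {f | ∃ i j : Fin n, j ∈ nonDescendants G i ∧ j ∉ parents G i ∧
    f = ciMinor (genericHat n) i j (parents G i)}

/-- The product of all principal minors of the generic symmetric matrix with ones on the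
diagonal. -/
def thetaHat (n : ℕ) : MvPolynomial (OffDiag n) ℂ :=
  ∏ A : Finset (Fin n), principalMinor (genericHat n) A

end GaussianDAG

end

/-! ### Krull dimension and transcendence degree. -/

noncomputable section

theorem ringKrullDim_eq_of_isIntegral_of_injective {R S : Type*} [CommRing R] [CommRing S]
    [Algebra R S] [Algebra.IsIntegral R S] (hinj : Function.Injective (algebraMap R S)) :
    ringKrullDim S = ringKrullDim R := by
  -- Incomparability keeps contracted chains strict; lying over and going up lift chains from `R` to
  -- `S`.
  refine le_antisymm (Order.krullDim_le_of_strictMono (PrimeSpectrum.comap (algebraMap R S))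
    fun p q h => Ideal.IsIntegral.comap_lt_comap h) (iSup_le fun l => ?_)
  have hker : RingHom.ker (algebraMap R S) ≤ (RelSeries.head l).asIdeal := by
    rw [(RingHom.injective_iff_ker_eq_bot _).1 hinj]; exact bot_le
  obtain ⟨Q, -, hQ, hlo⟩ := Ideal.exists_ideal_over_prime_of_isIntegral
    (RelSeries.head l).asIdeal (⊥ : Ideal S) (by simpa [RingHom.ker] using! hker)
  have : Q.LiesOver (RelSeries.head l).asIdeal := ⟨hlo.symm⟩
  obtain ⟨L, hL, -⟩ := Ideal.exists_ltSeries_of_hasGoingUp l Q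
  rw [← hL]
  exact Order.LTSeries.length_le_krullDim L

/-- Noether normalization: `A` is integral over a polynomial ring in s variables, which has the same
dimension and the same transcendence degree. -/
theorem ringKrullDim_eq_of_trdeg_eq {k A : Type} [Field k] [CommRing A] [IsDomain A] [Algebra k A]
    [Algebra.FiniteType k A] {d : ℕ} (hd : Algebra.trdeg k A = d) : ringKrullDim A = d := by
  obtain ⟨s, g, hg, hint⟩ := exists_integral_inj_algHom_of_fg k A
  let := g.toRingHom.toAlgebra
  have : Algebra.IsIntegral (MvPolynomial (Fin s) k) A := ⟨hint⟩
  have : FaithfulSMul (MvPolynomial (Fin s) k) A :=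
    (faithfulSMul_iff_algebraMap_injective _ _).2 hg
  have : IsScalarTower k (MvPolynomial (Fin s) k) A :=
    .of_algebraMap_eq fun r => (g.commutes r).symm
  have htr := trdeg_add_eq k (MvPolynomial (Fin s) k) (A := A)
  rw [trdeg_eq_zero (R := MvPolynomial (Fin s) k) (A := A), add_zero,
    MvPolynomial.trdeg_of_isDomain, hd] at htr
  have hs : s = d := by simpa using htr
  rw [ringKrullDim_eq_of_isIntegral_of_injective (R := MvPolynomial (Fin s) k) hg]
  simp [hs]

/-! ### Homomorphisms that become invertible on an open set. -/

section Birational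

variable {k A B : Type*} [Field k] [CommRing A] [CommRing B] [Algebra k A] [Algebra k B]

/-- An embedding of domains with a rational left inverse induces an isomorphism of the fields of
fractions. -/
theorem nonempty_fractionField_algEquiv {K L : Type*} [Field K] [Field L] [Algebra A K]
    [Algebra B L] [Algebra k K] [Algebra k L] [IsScalarTower k A K] [IsScalarTower k B L]
    [IsFractionRing A K] [IsFractionRing B L] {ψ : A →ₐ[k] B}
    (hψ : Function.Injective ψ) (s : B →ₐ[k] K)
    (h : ∀ f : K →ₐ[k] L,
      f.comp (IsScalarTower.toAlgHom k A K) = (IsScalarTower.toAlgHom k B L).comp ψ →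
        f.comp s = IsScalarTower.toAlgHom k B L) :
    Nonempty (K ≃ₐ[k] L) := by
  have hj : Function.Injective (IsScalarTower.toAlgHom k B L) := IsFractionRing.injective B L
  have hinj : Function.Injective ((IsScalarTower.toAlgHom k B L).comp ψ) := hj.comp hψ
  have hm : ∀ y : nonZeroDivisors A, IsUnit ((IsScalarTower.toAlgHom k B L).comp ψ y) :=
    fun y => IsUnit.mk0 _ fun h0 =>
      have := (IsFractionRing.injective A K).isDomain
      nonZeroDivisors.ne_zero y.2 ((map_eq_zero_iff _ hinj).1 h0)
  have hs := h (IsLocalization.liftAlgHom hm) (AlgHom.ext fun a => IsLocalization.lift_eq hm a)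
  refine ⟨AlgEquiv.ofBijective (IsLocalization.liftAlgHom hm)
    ⟨(IsLocalization.liftAlgHom hm : K →ₐ[k] L).toRingHom.injective, fun z => ?_⟩⟩
  -- The extension of `ψ` to `K` is onto: b / b' is the image of s(b) / s(b').
  have := (IsFractionRing.injective B L).isDomain
  obtain ⟨b, b', -, rfl⟩ := IsFractionRing.div_surjective B z
  refine ⟨s b / s b', ?_⟩
  rw [map_div₀]
  exact congrArg₂ (· / ·) (DFunLike.congr_fun hs b) (DFunLike.congr_fun hs b')

/-- An algebra homomorphism to a smooth algebra that becomes invertible away from `θ` shows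
smoothness away from `θ`. -/
theorem formallySmooth_away {T U : Type*} [CommRing T] [CommRing U] [Algebra A T]
    [Algebra B U] [Algebra k T] [Algebra k U] [IsScalarTower k A T] [IsScalarTower k B U]
    [Algebra.FormallySmooth k B] (ψ : A →ₐ[k] B) {θ : A}
    [IsLocalization.Away θ T] [IsLocalization.Away (ψ θ) U]
    (s : B →ₐ[k] T) (hs : s.comp ψ = IsScalarTower.toAlgHom k A T)
    (h : ∀ f : T →ₐ[k] U,
      f.comp (IsScalarTower.toAlgHom k A T) = (IsScalarTower.toAlgHom k B U).comp ψ →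
        f.comp s = IsScalarTower.toAlgHom k B U) :
    Algebra.FormallySmooth k T := by
  have hq : IsUnit (IsScalarTower.toAlgHom k A T θ) :=
    IsLocalization.Away.algebraMap_isUnit (S := T) θ
  have hj : IsUnit (IsScalarTower.toAlgHom k B U (ψ θ)) :=
    IsLocalization.Away.algebraMap_isUnit (S := U) (ψ θ)
  have hf' : ∀ y : Submonoid.powers θ, IsUnit ((IsScalarTower.toAlgHom k B U).comp ψ y) := by
    rintro ⟨_, m, rfl⟩
    rw [AlgHom.comp_apply, map_pow, map_pow]
    exact hj.pow m
  have hg' : ∀ y : Submonoid.powers (ψ θ), IsUnit (s y) := by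
    rintro ⟨_, m, rfl⟩
    rw [map_pow, show s (ψ θ) = _ from DFunLike.congr_fun hs θ]
    exact hq.pow m
  obtain ⟨f, hfq⟩ : ∃ f : T →ₐ[k] U, f.comp (IsScalarTower.toAlgHom k A T) =
      (IsScalarTower.toAlgHom k B U).comp ψ :=
    ⟨IsLocalization.liftAlgHom hf', AlgHom.ext fun a => IsLocalization.lift_eq hf' a⟩
  obtain ⟨g, hgj⟩ : ∃ g : U →ₐ[k] T, g.comp (IsScalarTower.toAlgHom k B U) = s :=
    ⟨IsLocalization.liftAlgHom hg', AlgHom.ext fun a => IsLocalization.lift_eq hg' a⟩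
  have hfg : f.comp g = AlgHom.id k U := by
    refine IsLocalization.algHom_ext (Submonoid.powers (ψ θ)) ?_
    change f.comp (g.comp (IsScalarTower.toAlgHom k B U)) = IsScalarTower.toAlgHom k B U
    rw [hgj]
    exact h _ hfq
  have hgf : g.comp f = AlgHom.id k T := by
    refine IsLocalization.algHom_ext (Submonoid.powers θ) ?_
    change g.comp (f.comp (IsScalarTower.toAlgHom k A T)) = IsScalarTower.toAlgHom k A T
    rw [hfq, ← AlgHom.comp_assoc, hgj]
    exact hs
  have : Algebra.FormallySmooth B U := .of_isLocalization (Submonoid.powers (ψ θ))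
  have : Algebra.FormallySmooth k U := .comp k B U
  exact .of_equiv (AlgEquiv.ofAlgHom g f hgf hfg)

end Birational

namespace GaussianDAG

open AffineVar

/-! ### Regressions along a topological order and the parametrization. -/

section

variable {n : ℕ} {R : Type*} [CommRing R]

lemma mem_parents {G : Digraph (Fin n)} {i j : Fin n} : j ∈ parents G i ↔ G.Adj j i := by
  simp [parents]

lemma mem_nonDescendants {G : Digraph (Fin n)} {i j : Fin n} :
    j ∈ nonDescendants G i ↔ ¬ Relation.ReflTransGen G.Adj i j := by
  simp [nonDescendants]

open Classical in
/-- The nodes from which a directed path of positive length leads to `i`. -/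
def ancestors (G : Digraph (Fin n)) (i : Fin n) : Finset (Fin n) :=
  Finset.univ.filter fun j => Relation.TransGen G.Adj j i

/-- An injective topological numbering of the nodes of an acyclic graph. -/
def topRank (G : Digraph (Fin n)) (i : Fin n) : ℕ := n * (ancestors G i).card + i

lemma topRank_injective (G : Digraph (Fin n)) : Function.Injective (topRank G) := by
  intro i j h
  have := congrArg (· % n) h
  simp only [topRank, Nat.mul_add_mod, Nat.mod_eq_of_lt i.2, Nat.mod_eq_of_lt j.2] at this
  exact Fin.ext this

/-- Along an edge the ancestor set grows strictly, since acyclicity keeps a node out of its own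
ancestors. The rank thus gains at least `n`, more than the tie-breaking index can take back. -/
lemma topRank_lt {G : Digraph (Fin n)} (hG : IsAcyclic G) {i j : Fin n} (h : G.Adj j i) :
    topRank G j < topRank G i := by
  have hlt : (ancestors G j).card < (ancestors G i).card := by
    refine Finset.card_lt_card ⟨fun k hk => ?_, fun hs => ?_⟩
    · simp only [ancestors, Finset.mem_filter_univ] at hk ⊢
      exact hk.tail h
    · have : j ∈ ancestors G j := hs (by simpa [ancestors] using Relation.TransGen.single h)
      exact hG j (by simpa [ancestors] using this)
  have := Nat.mul_le_mul_left n (Nat.succ_le_of_lt hlt)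
  simp only [topRank]
  have := j.2
  rw [Nat.mul_succ] at *
  omega

lemma topRank_le_of_reflTransGen {G : Digraph (Fin n)} (hG : IsAcyclic G) {i j : Fin n}
    (h : Relation.ReflTransGen G.Adj i j) : topRank G i ≤ topRank G j := by
  induction h with
  | refl => exact le_rfl
  | tail _ h ih => exact ih.trans (topRank_lt hG h).le

lemma mem_nonDescendants_of_topRank_lt {G : Digraph (Fin n)} (hG : IsAcyclic G) {i j : Fin n}
    (h : topRank G j < topRank G i) : j ∈ nonDescendants G i :=
  mem_nonDescendants.2 fun h' => absurd (topRank_le_of_reflTransGen hG h') (not_le.2 h)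

lemma parents_subset_nonDescendants {G : Digraph (Fin n)} (hG : IsAcyclic G) (i : Fin n) :
    parents G i ⊆ nonDescendants G i := fun _ hj =>
  mem_nonDescendants_of_topRank_lt hG (topRank_lt hG (mem_parents.1 hj))

/-- The entries of the matrix `c` obey the linear regressions of each node on its parents with
coefficients `L`. -/
def HasRegression (G : Digraph (Fin n)) (c L : Fin n → Fin n → R) : Prop :=
  ∀ i, ∀ j ∈ nonDescendants G i, c i j = ∑ k ∈ parents G i, L i k * c k j

/-- The correlation matrix with regression coefficients `L`. -/
def param (G : Digraph (Fin n)) (hG : IsAcyclic G) (L : Fin n → Fin n → R) (i j : Fin n) : R :=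
  if i = j then 1
  else if topRank G j < topRank G i then
    ∑ k : parents G i, L i k * param G hG L k j
  else ∑ k : parents G j, L j k * param G hG L k i
termination_by topRank G i + topRank G j
decreasing_by
  · have := topRank_lt hG (mem_parents.1 k.2); omega
  · have := topRank_lt hG (mem_parents.1 k.2); omega

section param

variable {G : Digraph (Fin n)} (hG : IsAcyclic G) (L : Fin n → Fin n → R)

@[simp] lemma param_self (i : Fin n) : param G hG L i i = 1 := by
  rw [param, if_pos rfl]

lemma param_of_lt {i j : Fin n} (h : topRank G j < topRank G i) :
    param G hG L i j = ∑ k ∈ parents G i, L i k * param G hG L k j := by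
  rw [param, if_neg (by rintro rfl; omega), if_pos h]
  exact Finset.sum_coe_sort (parents G i) fun k => L i k * param G hG L k j

lemma param_of_gt {i j : Fin n} (h : topRank G i < topRank G j) :
    param G hG L i j = ∑ k ∈ parents G j, L j k * param G hG L k i := by
  rw [param, if_neg (by rintro rfl; omega), if_neg (by omega)]
  exact Finset.sum_coe_sort (parents G j) fun k => L j k * param G hG L k i

lemma param_symm (i j : Fin n) : param G hG L i j = param G hG L j i := by
  rcases lt_trichotomy (topRank G i) (topRank G j) with h | h | h
  · rw [param_of_gt hG L h, param_of_lt hG L h]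
  · rw [topRank_injective G h]
  · rw [param_of_gt hG L h, param_of_lt hG L h]

/-- The recursion builds in the equation only for nodes j that precede i. If a non-descendant j
comes later, its parents are again non-descendants of i. Expanding the entry along pa(j), applying
induction to each parent and exchanging the two sums gives the regression of i. -/
lemma hasRegression_param : HasRegression G (param G hG L) L := by
  intro i j hj
  induction hr : topRank G j using Nat.strong_induction_on generalizing j with
  | _ r ih =>
  subst hr
  rcases lt_trichotomy (topRank G i) (topRank G j) with h | h | h
  · have hanc : ∀ l ∈ parents G j, l ∈ nonDescendants G i := fun l hl =>
      mem_nonDescendants.2 fun hil => mem_nonDescendants.1 hj (hil.tail (mem_parents.1 hl))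
    calc param G hG L i j = ∑ l ∈ parents G j, L j l * param G hG L i l := by
          rw [param_of_gt hG L h]
          simp_rw [fun l => param_symm hG L l i]
      _ = ∑ l ∈ parents G j, L j l * ∑ k ∈ parents G i, L i k * param G hG L k l := by
          refine Finset.sum_congr rfl fun l hl => ?_
          rw [ih _ (topRank_lt hG (mem_parents.1 hl)) l (hanc l hl) rfl]
      _ = ∑ k ∈ parents G i, L i k * ∑ l ∈ parents G j, L j l * param G hG L l k := by
          simp_rw [Finset.mul_sum]
          rw [Finset.sum_comm]
          refine Finset.sum_congr rfl fun k _ => Finset.sum_congr rfl fun l _ => ?_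
          rw [param_symm hG L k l]; ring
      _ = _ := by
          refine Finset.sum_congr rfl fun k hk => ?_
          rw [param_of_gt hG L ((topRank_lt hG (mem_parents.1 hk)).trans h)]
  · obtain rfl := topRank_injective G h
    exact absurd Relation.ReflTransGen.refl (mem_nonDescendants.1 hj)
  · exact param_of_lt hG L h

/-- The regression of the later of two nodes expresses their entry by entries of smaller total rank,
so the coefficients determine the matrix. -/
lemma eq_param {c : Fin n → Fin n → R} (hsymm : ∀ i j, c i j = c j i) (hdiag : ∀ i, c i i = 1)
    (hreg : HasRegression G c L) (i j : Fin n) : c i j = param G hG L i j := by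
  induction hr : topRank G i + topRank G j using Nat.strong_induction_on generalizing i j with
  | _ r ih =>
  subst hr
  have key : ∀ i' j', topRank G i' + topRank G j' = topRank G i + topRank G j →
      topRank G j' < topRank G i' → c i' j' = param G hG L i' j' := by
    intro i' j' hs h
    rw [hreg i' j' (mem_nonDescendants_of_topRank_lt hG h), param_of_lt hG L h]
    refine Finset.sum_congr rfl fun k hk => ?_
    have := topRank_lt hG (mem_parents.1 hk)
    rw [ih _ (by omega) k j' rfl]
  rcases lt_trichotomy (topRank G i) (topRank G j) with h | h | h
  · rw [hsymm, param_symm, key j i (add_comm _ _) h]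
  · rw [topRank_injective G h, hdiag, param_self]
  · exact key i j rfl h

/-- By uniqueness: the image matrix obeys the regressions with the image coefficients. -/
lemma map_param {S F : Type*} [CommRing S] [FunLike F R S] [RingHomClass F R S] (f : F)
    (i j : Fin n) :
    f (param G hG L i j) = param G hG (fun i k => f (L i k)) i j := by
  refine eq_param (c := fun i j => f (param G hG L i j)) hG _ (fun i j => ?_) (fun i => ?_)
    (fun i j hj => ?_) i j
  · rw [param_symm]
  · simp
  · simp [hasRegression_param hG L i j hj]

lemma param_congr {L L' : Fin n → Fin n → R} (h : ∀ i, ∀ k ∈ parents G i, L i k = L' i k)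
    (i j : Fin n) : param G hG L i j = param G hG L' i j := by
  refine eq_param hG L' (param_symm hG L) (param_self hG L) (fun i j hj => ?_) i j
  rw [hasRegression_param hG L i j hj]
  exact Finset.sum_congr rfl fun k hk => by rw [h i k hk]

end param

/-- The edges of `G`. -/
abbrev Edge (G : Digraph (Fin n)) : Type := {e : Fin n × Fin n // G.Adj e.1 e.2}

open Classical in
/-- The array of regression coefficients with prescribed entries on the edges: the coefficient of
`k` in the regression of `i` is attached to the edge `k → i`. -/
def edgeCoeff {G : Digraph (Fin n)} (l : Edge G → R) (i k : Fin n) : R :=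
  if h : G.Adj k i then l ⟨(k, i), h⟩ else 0

lemma map_edgeCoeff {S F : Type*} [CommRing S] [FunLike F R S] [RingHomClass F R S] (f : F)
    {G : Digraph (Fin n)} (l : Edge G → R) (i k : Fin n) :
    f (edgeCoeff l i k) = edgeCoeff (fun e => f (l e)) i k := by
  unfold edgeCoeff
  split_ifs <;> simp

lemma edgeCoeff_restrict {G : Digraph (Fin n)} (L : Fin n → Fin n → R) {i k : Fin n}
    (hk : k ∈ parents G i) : edgeCoeff (fun e : Edge G => L e.1.2 e.1.1) i k = L i k := by
  rw [edgeCoeff, dif_pos (mem_parents.1 hk)]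

/-- The off-diagonal coordinates of the correlation matrix with regression coefficients `l`. -/
def paramPoint (G : Digraph (Fin n)) (hG : IsAcyclic G) (l : Edge G → R) : OffDiag n → R :=
  fun e => Sym2.lift ⟨param G hG (edgeCoeff l), param_symm hG _⟩ e.1

section paramPoint

variable {G : Digraph (Fin n)} (hG : IsAcyclic G)

lemma symMatrix_unitDiag_self (c : OffDiag n → R) (i : Fin n) :
    symMatrix (unitDiag c) i i = 1 := by
  simp [symMatrix, unitDiag]

omit [CommRing R] in
lemma symMatrix_comm (c : Sym2 (Fin n) → R) (i j : Fin n) :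
    symMatrix c i j = symMatrix c j i := by
  simp [symMatrix, Sym2.eq_swap]

lemma symMatrix_paramPoint (l : Edge G → R) (i j : Fin n) :
    symMatrix (unitDiag (paramPoint G hG l)) i j = param G hG (edgeCoeff l) i j := by
  by_cases h : i = j
  · subst h; rw [symMatrix_unitDiag_self, param_self]
  · simp [symMatrix, unitDiag, h, paramPoint]

lemma map_paramPoint {S F : Type*} [CommRing S] [FunLike F R S] [RingHomClass F R S] (f : F)
    (l : Edge G → R) (e : OffDiag n) :
    f (paramPoint G hG l e) = paramPoint G hG (fun e => f (l e)) e := by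
  obtain ⟨e, he⟩ := e
  induction e with
  | _ i j =>
  simp only [paramPoint, Sym2.lift_mk]
  rw [map_param]
  congr 1
  ext i k
  rw [map_edgeCoeff]

lemma hatPoint_ext {c c' : OffDiag n → R}
    (h : ∀ i j, symMatrix (unitDiag c) i j = symMatrix (unitDiag c') i j) : c = c' := by
  funext ⟨e, he⟩
  induction e with
  | _ i j => simpa [symMatrix, unitDiag, show i ≠ j by simpa using he] using h i j

lemma eq_paramPoint {c : OffDiag n → R} {L : Fin n → Fin n → R}
    (h : HasRegression G (symMatrix (unitDiag c)) L) :
    c = paramPoint G hG fun e => L e.1.2 e.1.1 := by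
  refine hatPoint_ext fun i j => ?_
  rw [symMatrix_paramPoint, eq_param hG L (symMatrix_comm _) (symMatrix_unitDiag_self c) h]
  exact param_congr hG (fun i k hk => (edgeCoeff_restrict L hk).symm) i j

lemma hasRegression_paramPoint (l : Edge G → R) :
    HasRegression G (symMatrix (unitDiag (paramPoint G hG l))) (edgeCoeff l) := by
  intro i j hj
  simp_rw [symMatrix_paramPoint]
  exact hasRegression_param hG _ i j hj

lemma paramPoint_zero : paramPoint G hG (0 : Edge G → R) = 0 := by
  have h : HasRegression G (symMatrix (unitDiag (0 : OffDiag n → R))) 0 := fun i j hj => by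
    have : i ≠ j := by rintro rfl; exact mem_nonDescendants.1 hj .refl
    simp [symMatrix, unitDiag, this]
  exact (eq_paramPoint hG h).symm

end paramPoint

end

/-! ### Minors, regressions and points over ℂ-algebras. -/

section

variable {n : ℕ} {R : Type*} [CommRing R]

lemma ciMinor_eq_zero_of_eq_sum [IsDomain R] {M : Matrix (Fin n) (Fin n) R} {i j : Fin n}
    {K : Finset (Fin n)} {v : Fin n → R} (hj : M i j = ∑ k ∈ K, v k * M k j)
    (hK : ∀ l ∈ K, M i l = ∑ k ∈ K, v k * M k l) : ciMinor M i j K = 0 := by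
  -- The vector (-1, v) is a nonzero left kernel vector of the bordered matrix.
  refine Matrix.exists_vecMul_eq_zero_iff.1
    ⟨fun o : Option K => o.elim (-1) fun k => v k, fun h => ?_, ?_⟩
  · simpa using congrFun h none
  · funext o
    rw [Matrix.vecMul, dotProduct, Fintype.sum_option]
    cases o with
    | none => simp [hj, ← Finset.sum_coe_sort K]
    | some l => simp [hK l l.2, ← Finset.sum_coe_sort K]

/-- With v = M_iK M_KK⁻¹, the Schur complement gives |M_{iK,jK}| = |M_KK| (M_ij - v M_Kj), and the
first factor is a unit. The same v serves all j. -/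
lemma exists_eq_sum_of_ciMinor_eq_zero {M : Matrix (Fin n) (Fin n) R} {i : Fin n}
    {K : Finset (Fin n)} (hK : IsUnit (principalMinor M K)) :
    ∃ v : Fin n → R, ∀ j, (j ∈ K ∨ ciMinor M i j K = 0) → M i j = ∑ k ∈ K, v k * M k j := by
  classical
  set N := M.submatrix (fun a : K => (a : Fin n)) (fun a : K => (a : Fin n)) with hN
  have hdet : IsUnit N.det := hK
  let w : K → R := Matrix.vecMul (fun l : K => M i l) N⁻¹
  have hw : Matrix.vecMul w N = fun l : K => M i l := by
    rw [Matrix.vecMul_vecMul, Matrix.nonsing_inv_mul _ hdet, Matrix.vecMul_one]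
  refine ⟨fun k => if h : k ∈ K then w ⟨k, h⟩ else 0, fun j hj => ?_⟩
  have hsum : ∀ j, ∑ k ∈ K, (if h : k ∈ K then w ⟨k, h⟩ else 0) * M k j =
      ∑ k : K, w k * M k j := fun j => by
    rw [← Finset.sum_coe_sort K]
    exact Finset.sum_congr rfl fun k _ => by rw [dif_pos k.2]
  rw [hsum]
  by_cases hjK : j ∈ K
  · exact (congrFun hw ⟨j, hjK⟩).symm
  have hzero := hj.resolve_left hjK
  let B : Matrix (K ⊕ Unit) (K ⊕ Unit) R := Matrix.fromBlocks N (.of fun k _ => M k j)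
    (.of fun _ k => M i k) (.of fun _ _ => M i j)
  have hB : ciMinor M i j K = B.det := by
    rw [ciMinor, ← Matrix.det_submatrix_equiv_self (Equiv.optionEquivSumPUnit K).symm]
    congr 1
    ext a b
    rcases a with a | a <;> rcases b with b | b <;> simp [B, hN]
  let := N.invertibleOfIsUnitDet hdet
  rw [hB, Matrix.det_fromBlocks₁₁, hdet.mul_right_eq_zero, Matrix.det_unique,
    Matrix.invOf_eq_nonsing_inv] at hzero
  have := sub_eq_zero.1 hzero
  simp only [Matrix.of_apply] at this
  rw [this]
  rfl

lemma map_principalMinor {S : Type*} [CommRing S] (f : R →+* S)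
    (M : Matrix (Fin n) (Fin n) R) (A : Finset (Fin n)) :
    f (principalMinor M A) = principalMinor (M.map f) A := by
  rw [principalMinor, RingHom.map_det]; rfl

lemma map_ciMinor {S : Type*} [CommRing S] (f : R →+* S)
    (M : Matrix (Fin n) (Fin n) R) (i j : Fin n) (K : Finset (Fin n)) :
    f (ciMinor M i j K) = ciMinor (M.map f) i j K := by
  rw [ciMinor, RingHom.map_det, ciMinor]
  rfl

section aeval

variable [Algebra ℂ R] (c : OffDiag n → R)

lemma map_genericHat :
    (genericHat n).map (aeval c : MvPolynomial (OffDiag n) ℂ →ₐ[ℂ] R).toRingHom =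
      symMatrix (unitDiag c) := by
  ext i j
  by_cases h : i = j <;> simp [genericHat, symMatrix, unitDiag, h]

lemma aeval_principalMinor (A : Finset (Fin n)) :
    aeval c (principalMinor (genericHat n) A) = principalMinor (symMatrix (unitDiag c)) A := by
  rw [← map_genericHat]
  exact map_principalMinor (aeval c : MvPolynomial (OffDiag n) ℂ →ₐ[ℂ] R).toRingHom _ _

lemma aeval_ciMinor (i j : Fin n) (K : Finset (Fin n)) :
    aeval c (ciMinor (genericHat n) i j K) = ciMinor (symMatrix (unitDiag c)) i j K := by
  rw [← map_genericHat]
  exact map_ciMinor (aeval c : MvPolynomial (OffDiag n) ℂ →ₐ[ℂ] R).toRingHom _ _ _ _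

lemma isUnit_principalMinor {c : OffDiag n → R} (h : IsUnit (aeval c (thetaHat n)))
    (A : Finset (Fin n)) : IsUnit (principalMinor (symMatrix (unitDiag c)) A) := by
  rw [← aeval_principalMinor]
  exact isUnit_of_dvd_unit (map_dvd _ (Finset.dvd_prod_of_mem _ (Finset.mem_univ A))) h

variable {G : Digraph (Fin n)} (hG : IsAcyclic G)

lemma aeval_paramPoint_eq_zero [IsDomain R] (l : Edge G → R) {f : MvPolynomial (OffDiag n) ℂ}
    (hf : f ∈ idealHat G) : aeval (paramPoint G hG l) f = 0 := by
  have hle : idealHat G ≤ RingHom.ker (aeval (paramPoint G hG l) :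
      MvPolynomial (OffDiag n) ℂ →ₐ[ℂ] R) := by
    refine Ideal.span_le.2 ?_
    rintro _ ⟨i, j, hj, -, rfl⟩
    refine RingHom.mem_ker.2 ?_
    rw [aeval_ciMinor]
    exact ciMinor_eq_zero_of_eq_sum (hasRegression_paramPoint hG l i j hj) fun k hk =>
      hasRegression_paramPoint hG l i k (parents_subset_nonDescendants hG i hk)
  exact hle hf

lemma exists_eq_paramPoint {c : OffDiag n → R} (hθ : IsUnit (aeval c (thetaHat n)))
    (hI : ∀ f ∈ idealHat G, aeval c f = 0) : ∃ l : Edge G → R, c = paramPoint G hG l := by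
  choose L hL using fun i =>
    exists_eq_sum_of_ciMinor_eq_zero (i := i) (isUnit_principalMinor hθ (parents G i))
  refine ⟨_, eq_paramPoint hG (L := L) fun i j hj => hL i j ?_⟩
  by_cases hjK : j ∈ parents G i
  · exact .inl hjK
  · refine .inr ?_
    rw [← aeval_ciMinor]
    exact hI _ (Ideal.subset_span ⟨i, j, hj, hjK, rfl⟩)

/-- Parents are non-descendants, so the coefficients of node i solve the normal equations λ_i M_KK =
M_iK for K = pa(i), whose matrix is invertible. -/
lemma paramPoint_injective_of_isUnit {l l' : Edge G → R}
    (hθ : IsUnit (aeval (paramPoint G hG l) (thetaHat n)))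
    (h : paramPoint G hG l = paramPoint G hG l') : l = l' := by
  funext ⟨⟨k, i⟩, hk⟩
  set M := symMatrix (unitDiag (paramPoint G hG l)) with hM
  have h1 := hasRegression_paramPoint hG l
  have h2 := hasRegression_paramPoint hG l'
  rw [← h, ← hM] at h2
  rw [← hM] at h1
  have hunit := isUnit_principalMinor hθ (parents G i)
  have hinj := Matrix.vecMul_injective_of_isUnit ((Matrix.isUnit_iff_isUnit_det _).2 hunit)
  have key : (fun k : parents G i => edgeCoeff l i k) =
      fun k : parents G i => edgeCoeff l' i k := by
    refine hinj (funext fun j => ?_)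
    have e1 := h1 i j (parents_subset_nonDescendants hG i j.2)
    have e2 := h2 i j (parents_subset_nonDescendants hG i j.2)
    rw [← Finset.sum_coe_sort] at e1 e2
    exact e1.symm.trans e2
  have := congrFun key ⟨k, mem_parents.2 hk⟩
  simpa [edgeCoeff, show G.Adj k i from hk] using this

end aeval

end

/-! ### Linear regression and conditional independence. -/

section

open scoped MatrixOrder Matrix.Norms.L2Operator in
/-- The normal equations of a linear regression are solvable, also for singular covariances. -/
lemma exists_regression_of_posSemidef {ι : Type*} [Fintype ι] [DecidableEq ι]
    {S : Matrix ι ι ℝ} (hS : S.PosSemidef) (i : ι) (K : Finset ι) :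
    ∃ v : ι → ℝ, ∀ j ∈ K, S i j = ∑ k ∈ K, v k * S k j := by
  -- Write S as a Gram matrix of vectors b_k. Projecting b_i orthogonally to the span of the b_k
  -- with k in K gives the coefficients, even if these vectors are dependent.
  obtain ⟨B, hB⟩ := CStarAlgebra.nonneg_iff_eq_star_mul_self.1 hS.nonneg
  let b : ι → EuclideanSpace ℝ ι := fun k => WithLp.toLp 2 fun l => B l k
  have hb : ∀ k l, S k l = inner ℝ (b k) (b l) := fun k l => by
    rw [hB]
    simp [b, Matrix.mul_apply, PiLp.inner_apply, Matrix.star_eq_conjTranspose, mul_comm]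
  let V := Submodule.span ℝ (b '' K)
  obtain ⟨v, hv⟩ := Submodule.mem_span_image_finset_iff_exists_fun' ℝ |>.1
    (V.starProjection_apply_mem (b i))
  refine ⟨v, fun j hj => ?_⟩
  have := V.starProjection_inner_eq_zero (b i) (b j)
    (Submodule.subset_span (Set.mem_image_of_mem _ hj))
  rw [← hv, inner_sub_left, sub_eq_zero, sum_inner] at this
  simp_rw [real_inner_smul_left, ← hb] at this
  exact this

section CondIndep

variable {Ω γ : Type*} {mΩ : MeasurableSpace Ω} [StandardBorelSpace Ω] {mγ : MeasurableSpace γ}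
  {μ : Measure Ω} [IsProbabilityMeasure μ] {Z : Ω → γ}

/-- If `X` and `Y` are conditionally independent given `Z` and the residual `X - l(Z)` is
independent of `Z`, then the residual is uncorrelated with `Y`. -/
lemma covariance_residual_eq_zero {X Y : Ω → ℝ} {l : γ → ℝ} (hZ : Measurable Z)
    (hX : Measurable X) (hY : Measurable Y) (hl : Measurable l)
    (hε2 : MemLp (fun ω => X ω - l (Z ω)) 2 μ) (hY2 : MemLp Y 2 μ)
    (hind : CondIndepFun (mγ.comap Z) hZ.comap_le X Y μ)
    (hε : IndepFun (fun ω => X ω - l (Z ω)) Z μ) :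
    cov[fun ω => X ω - l (Z ω), Y; μ] = 0 := by
  set ε : Ω → ℝ := fun ω => X ω - l (Z ω) with hεdef
  have hYi : Integrable Y μ := hY2.integrable one_le_two
  have hεi : Integrable ε μ := hε2.integrable one_le_two
  have hW : Measurable fun ω => (Z ω, X ω) := hZ.prodMk hX
  -- Given (Z, X), the conditional law of Y depends on Z alone, so E[Y | Z, X] = h(Z). Since ε is a
  -- function of (Z, X), it pulls out: E[εY] = E[ε h(Z)] = E[ε] E[h(Z)] = E[ε] E[Y].
  have hcd := (condIndepFun_iff_condDistrib_prod_ae_eq_prodMkRight hY hX hZ).1 hind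
  let h : γ → ℝ := fun z => ∫ y, y ∂condDistrib Y Z μ z
  have hh : Measurable h := by
    have : StronglyMeasurable fun p : γ × ℝ => p.2 := measurable_snd.stronglyMeasurable
    exact this.integral_condDistrib.measurable
  have h1 : μ[Y | MeasurableSpace.comap (fun ω => (Z ω, X ω)) inferInstance] =ᵐ[μ]
      fun ω => h (Z ω) := by
    refine (condExp_ae_eq_integral_condDistrib' hW hYi).trans ?_
    filter_upwards [ae_of_ae_map hW.aemeasurable hcd] with ω hω
    rw [hω]; rfl
  have h2 : μ[Y | mγ.comap Z] =ᵐ[μ] fun ω => h (Z ω) := condExp_ae_eq_integral_condDistrib' hZ hYi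
  have hεm : StronglyMeasurable[MeasurableSpace.comap (fun ω => (Z ω, X ω)) inferInstance] ε := by
    have : Measurable fun p : γ × ℝ => p.2 - l p.1 := by fun_prop
    exact (this.comp (comap_measurable fun ω => (Z ω, X ω))).stronglyMeasurable
  have hpull := condExp_mul_of_stronglyMeasurable_left hεm (hε2.integrable_mul hY2) hYi
  have e1 : ∫ ω, ε ω * Y ω ∂μ = ∫ ω, ε ω * h (Z ω) ∂μ := by
    rw [← integral_condExp (f := fun ω => ε ω * Y ω) hW.comap_le]
    refine integral_congr_ae (hpull.trans ?_)
    filter_upwards [h1] with ω hω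
    simp [hω]
  have e2 : ∫ ω, ε ω * h (Z ω) ∂μ = (∫ ω, ε ω ∂μ) * ∫ ω, h (Z ω) ∂μ :=
    (hε.comp measurable_id hh).integral_fun_mul_eq_mul_integral hεi.1
      (hh.comp hZ).aestronglyMeasurable
  have e3 : ∫ ω, h (Z ω) ∂μ = ∫ ω, Y ω ∂μ := by
    rw [← integral_congr_ae h2, integral_condExp hZ.comap_le]
  rw [covariance_eq_sub hε2 hY2, sub_eq_zero]
  simp only [Pi.mul_apply]
  rw [e1, e2, e3]

/-- The law of `e + l(z)` for a random number `e` of law `ν`. -/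
def shiftKernel (ν : Measure ℝ) {l : γ → ℝ} (_ : Measurable l) : Kernel γ ℝ :=
  (Kernel.id ×ₖ Kernel.const γ ν).map fun p => p.2 + l p.1

lemma shiftKernel_apply (ν : Measure ℝ) [SFinite ν] {l : γ → ℝ} (hl : Measurable l) (z : γ)
    {s : Set ℝ} (hs : MeasurableSet s) : shiftKernel ν hl z s = ν ((fun e => e + l z) ⁻¹' s) := by
  have hm : Measurable fun p : γ × ℝ => p.2 + l p.1 := by fun_prop
  rw [shiftKernel, Kernel.map_apply' _ hm _ hs, Kernel.prod_apply, Kernel.id_apply,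
    Kernel.const_apply, Measure.dirac_prod, Measure.map_apply (by fun_prop) (hm hs)]
  rfl

instance (ν : Measure ℝ) [IsProbabilityMeasure ν] {l : γ → ℝ} (hl : Measurable l) :
    IsMarkovKernel (shiftKernel ν hl) :=
  ⟨fun z => ⟨by rw [shiftKernel_apply _ _ _ .univ]; simp⟩⟩

omit [StandardBorelSpace Ω] in
lemma map_prodMk_eq_compProd_shiftKernel {δ : Type*} {mδ : MeasurableSpace δ} {W : Ω → δ}
    {ε : Ω → ℝ} {l : γ → ℝ} {p : δ → γ} (hW : Measurable W) (hε : Measurable ε)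
    (hl : Measurable l) (hp : Measurable p) (hind : IndepFun W ε μ) :
    μ.map (fun ω => (W ω, ε ω + l (p (W ω)))) =
      μ.map W ⊗ₘ (shiftKernel (μ.map ε) hl).comap p hp := by
  have : IsProbabilityMeasure (μ.map ε) := Measure.isProbabilityMeasure_map hε.aemeasurable
  have hT : Measurable fun q : δ × ℝ => (q.1, q.2 + l (p q.1)) := by fun_prop
  ext s hs
  have : (fun ω => (W ω, ε ω + l (p (W ω)))) =
      (fun q : δ × ℝ => (q.1, q.2 + l (p q.1))) ∘ fun ω => (W ω, ε ω) := rfl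
  rw [this, ← Measure.map_map hT (hW.prodMk hε),
    (indepFun_iff_map_prod_eq_prod_map_map hW.aemeasurable hε.aemeasurable).1 hind,
    Measure.map_apply hT hs, Measure.prod_apply (hT hs), Measure.compProd_apply hs]
  refine lintegral_congr fun w => ?_
  rw [Kernel.comap_apply, shiftKernel_apply _ _ _ (measurable_prodMk_left hs)]
  rfl

/-- If `ε` is independent of `Y` and `Z` is a function of `Y`, then `ε + l(Z)` and `Y` are
conditionally independent given `Z`. -/
lemma condIndepFun_of_indepFun {β : Type*} {mβ : MeasurableSpace β} [StandardBorelSpace β]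
    [Nonempty β] {Y : Ω → β} {ε : Ω → ℝ} {l : γ → ℝ} {p : β → γ} (hY : Measurable Y)
    (hε : Measurable ε) (hl : Measurable l) (hp : Measurable p) (hZ : Measurable Z)
    (hZY : ∀ ω, Z ω = p (Y ω)) (hind : IndepFun ε Y μ) :
    CondIndepFun (mγ.comap Z) hZ.comap_le (fun ω => ε ω + l (Z ω)) Y μ := by
  have : IsProbabilityMeasure (μ.map ε) := Measure.isProbabilityMeasure_map hε.aemeasurable
  obtain rfl : Z = fun ω => p (Y ω) := funext hZY
  have hX : Measurable fun ω => ε ω + l (p (Y ω)) := by fun_prop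
  refine CondIndepFun.symm ((condIndepFun_iff_condDistrib_prod_ae_eq_prodMkRight hX hY hZ).2 ?_)
  -- The conditional laws given (Z, Y) and given Z are the same shift of the law of ε, and this is
  -- the conditional independence.
  have h1 := condDistrib_ae_eq_of_measure_eq_compProd _ hX.aemeasurable
    (map_prodMk_eq_compProd_shiftKernel (W := fun ω => (p (Y ω), Y ω)) (p := Prod.fst)
      (by fun_prop) hε hl measurable_fst
      (hind.symm.comp (φ := fun y => (p y, y)) (by fun_prop) measurable_id))
  have h2 := condDistrib_ae_eq_of_measure_eq_compProd _ hX.aemeasurable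
    (map_prodMk_eq_compProd_shiftKernel (W := fun ω => p (Y ω)) (p := id)
      hZ hε hl measurable_id (hind.symm.comp hp measurable_id))
  have h3 : ∀ᵐ w ∂μ.map fun ω => (p (Y ω), Y ω), condDistrib (fun ω => ε ω + l (p (Y ω)))
      (fun ω => p (Y ω)) μ w.1 = shiftKernel (μ.map ε) hl w.1 := by
    have hfst : (μ.map fun ω => (p (Y ω), Y ω)).map Prod.fst = μ.map fun ω => p (Y ω) := by
      rw [Measure.map_map measurable_fst (by fun_prop)]; rfl
    refine ae_of_ae_map (p := fun z => condDistrib (fun ω => ε ω + l (p (Y ω)))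
      (fun ω => p (Y ω)) μ z = shiftKernel (μ.map ε) hl z) measurable_fst.aemeasurable ?_
    rw [hfst]
    exact h2
  filter_upwards [h1, h3] with w hw1 hw3
  rw [hw1, Kernel.comap_apply, Kernel.prodMkRight_apply, hw3]

end CondIndep

end

/-! ### The Gaussian model as a set of matrices. -/

section

variable {n : ℕ}

lemma memLp_coord (μ : Measure (Fin n → ℝ)) [IsGaussian μ] (i : Fin n) :
    MemLp (fun x : Fin n → ℝ => x i) 2 μ :=
  (HasGaussianLaw.eval (X := fun i (x : Fin n → ℝ) => x i)
    (IsGaussian.hasGaussianLaw_id (μ := μ)) i).memLp_two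

lemma posSemidef_covariance (μ : Measure (Fin n → ℝ)) [IsGaussian μ] :
    (Matrix.of fun i j : Fin n => cov[fun x : Fin n → ℝ => x i, fun x => x j; μ]).PosSemidef := by
  refine .of_dotProduct_mulVec_nonneg ?_ fun u => ?_
  · ext i j
    simp [covariance_comm]
  · have h : cov[fun x : Fin n → ℝ => ∑ i, u i * x i, fun x => ∑ j, u j * x j; μ] =
        star u ⬝ᵥ (Matrix.of fun i j : Fin n =>
          cov[fun x : Fin n → ℝ => x i, fun x => x j; μ]).mulVec u := by
      rw [covariance_fun_sum_fun_sum (fun i => (memLp_coord μ i).const_mul _)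
        (fun i => (memLp_coord μ i).const_mul _)]
      simp only [dotProduct, Matrix.mulVec, Matrix.of_apply, Finset.mul_sum, Pi.star_apply,
        star_trivial]
      refine Finset.sum_congr rfl fun i _ => Finset.sum_congr rfl fun j _ => ?_
      rw [covariance_const_mul_left, covariance_const_mul_right]
      ring
    rw [← h, covariance_self (Measurable.aemeasurable (by fun_prop))]
    exact variance_nonneg _ _

variable {G : Digraph (Fin n)}

lemma covariance_sub_sum (μ : Measure (Fin n → ℝ)) [IsGaussian μ] (i j : Fin n)
    (K : Finset (Fin n)) (v : Fin n → ℝ) :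
    cov[fun x : Fin n → ℝ => x i - ∑ k : K, v k * x k, fun x => x j; μ] =
      cov[fun x => x i, fun x => x j; μ] -
        ∑ k ∈ K, v k * cov[fun x : Fin n → ℝ => x k, fun x => x j; μ] := by
  have hv : ∀ k : K, MemLp (fun x : Fin n → ℝ => v k * x k) 2 μ :=
    fun k => (memLp_coord μ k).const_mul _
  rw [covariance_fun_sub_left (memLp_coord μ i) (memLp_finsetSum _ fun k _ => hv k)
    (memLp_coord μ j), covariance_fun_sum_left hv (memLp_coord μ j), ← Finset.sum_coe_sort K]
  simp_rw [covariance_const_mul_left]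

/-- The residual and the coordinates in `N` are jointly Gaussian, being linear in one Gaussian
vector, so being uncorrelated makes them independent. -/
lemma indepFun_residual (μ : Measure (Fin n → ℝ)) [IsGaussian μ] (i : Fin n)
    (K N : Finset (Fin n)) (v : Fin n → ℝ)
    (h : ∀ j ∈ N, cov[fun x : Fin n → ℝ => x i - ∑ k : K, v k * x k, fun x => x j; μ] = 0) :
    IndepFun (fun x : Fin n → ℝ => x i - ∑ k : K, v k * x k)
      (fun (x : Fin n → ℝ) (j : N) => x j) μ := by
  let L : (Fin n → ℝ) →L[ℝ] (Unit → ℝ) × (N → ℝ) :=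
    (ContinuousLinearMap.pi fun _ => (ContinuousLinearMap.proj (R := ℝ) (φ := fun _ : Fin n => ℝ) i -
      ∑ k : K, v k • ContinuousLinearMap.proj (R := ℝ) (φ := fun _ : Fin n => ℝ) (k : Fin n))).prod
    (ContinuousLinearMap.pi fun j =>
      ContinuousLinearMap.proj (R := ℝ) (φ := fun _ : Fin n => ℝ) (j : Fin n))
  have hL : HasGaussianLaw (fun x : Fin n → ℝ =>
      ((fun _ : Unit => x i - ∑ k : K, v k * x k), fun j : N => x j)) μ := by
    have := (IsGaussian.hasGaussianLaw_id (μ := μ)).map_fun L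
    have hLx : (fun x : Fin n → ℝ => L (id x)) = fun x =>
        ((fun _ : Unit => x i - ∑ k : K, v k * x k), fun j : N => x j) := by
      funext x
      refine Prod.ext (funext fun _ => ?_) (funext fun j => ?_) <;> simp [L]
    rwa [hLx] at this
  have := hL.indepFun_of_covariance_eval
    (X := fun (_ : Unit) (x : Fin n → ℝ) => x i - ∑ k : K, v k * x k) (Y := fun (j : N) (x : Fin n → ℝ) => x j)
    fun _ j => h j j.2
  exact this.comp (measurable_pi_apply ()) measurable_id

/-- The covariance matrices in the model are the real positive semidefinite matrices whose entries
obey the regressions of the nodes on their parents. -/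
lemma mem_loc_iff (hG : IsAcyclic G) {σ : SymPoint n} :
    σ ∈ loc G ↔ ∃ S : Matrix (Fin n) (Fin n) ℝ, S.PosSemidef ∧ (∃ L, HasRegression G S L) ∧
      ∀ i j, σ s(i, j) = S i j := by
  constructor
  · rintro ⟨μ, _, hμ, hc, hσ⟩
    refine ⟨_, posSemidef_covariance μ, ?_, hσ⟩
    -- The normal equations make the residual uncorrelated with the parents, hence independent of
    -- them. Conditional independence then makes it uncorrelated with every non-descendant, which is
    -- the regression equation.
    choose L hL using fun i =>
      exists_regression_of_posSemidef (posSemidef_covariance μ) i (parents G i)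
    refine ⟨L, fun i j hj => ?_⟩
    simp only [Matrix.of_apply] at hL ⊢
    rw [← sub_eq_zero, ← covariance_sub_sum]
    have hmem : MemLp (fun x : Fin n → ℝ => x i - ∑ k : parents G i, L i k * x k) 2 μ :=
      (memLp_coord μ i).sub (memLp_finsetSum _ fun k _ => (memLp_coord μ k).const_mul _)
    have hcj : CondIndepFun _ _ (fun x : Fin n → ℝ => x i) (fun x => x j) μ :=
      (hc i).comp measurable_id (measurable_pi_apply (⟨j, hj⟩ : nonDescendants G i))
    exact covariance_residual_eq_zero (Z := fun (x : Fin n → ℝ) (k : parents G i) => x k)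
      (l := fun z => ∑ k : parents G i, L i k * z k) (by fun_prop) (by fun_prop) (by fun_prop) (by fun_prop)
      hmem (memLp_coord μ j) hcj
      (indepFun_residual μ i _ _ _ fun l hl => by rw [covariance_sub_sum, hL i l hl, sub_self])
  · rintro ⟨S, hS, ⟨L, hL⟩, hσ⟩
    let e := (EuclideanSpace.equiv (Fin n) ℝ).toContinuousLinearMap
    let μ := (multivariateGaussian 0 S).map e
    have : IsProbabilityMeasure μ := Measure.isProbabilityMeasure_map (by fun_prop)
    have hμ : IsGaussian μ := inferInstance
    have hcov : ∀ i j, cov[fun x : Fin n → ℝ => x i, fun x => x j; μ] = S i j := fun i j => by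
      rw [covariance_map_fun (measurable_pi_apply i).aestronglyMeasurable
        (measurable_pi_apply j).aestronglyMeasurable (by fun_prop)]
      exact covariance_eval_multivariateGaussian hS i j
    refine ⟨μ, this, hμ, fun i => ?_, fun i j => by rw [hσ, hcov]⟩
    -- For the centred Gaussian with covariance S the regressions say that the residual is
    -- uncorrelated with all non-descendants, hence independent of them jointly.
    have hind := indepFun_residual μ i (parents G i) (nonDescendants G i) (L i) fun j hj => by
      rw [covariance_sub_sum, hcov, hL i j hj, sub_eq_zero]
      simp_rw [hcov]
    have := condIndepFun_of_indepFun
      (Z := fun (x : Fin n → ℝ) (k : parents G i) => x k)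
      (Y := fun (x : Fin n → ℝ) (j : nonDescendants G i) => x j)
      (l := fun z => ∑ k : parents G i, L i k * z k)
      (p := fun y k => y ⟨k, parents_subset_nonDescendants hG i k.2⟩)
      (by fun_prop) (by fun_prop) (by fun_prop) (by fun_prop) (by fun_prop) (fun _ => rfl) hind
    simpa using this

end

/-! ### A box inside the model and the vanishing ideal. -/

section

variable {n : ℕ}

/-- With |x_i x_j| ≤ (x_i² + x_j²)/2, the deviation from the identity costs at most n/(n+1) · Σ
x_i², leaving Σ x_i²/(n+1) > 0. -/
lemma posDef_of_abs_le {S : Matrix (Fin n) (Fin n) ℝ} (hsymm : ∀ i j, S i j = S j i)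
    (hS : ∀ i j, |S i j - (1 : Matrix (Fin n) (Fin n) ℝ) i j| ≤ 1 / (n + 1)) : S.PosDef := by
  refine .of_dotProduct_mulVec_pos (Matrix.ext fun i j => by simp [hsymm j i]) fun x hx => ?_
  have hpos : 0 < ∑ i, x i ^ 2 := by
    obtain ⟨i, hi⟩ := Function.ne_iff.1 hx
    exact Finset.sum_pos' (fun _ _ => sq_nonneg _) ⟨i, Finset.mem_univ _, by
      have : x i ≠ 0 := hi
      positivity⟩
  have hterm : ∀ i j, (1 : Matrix (Fin n) (Fin n) ℝ) i j * (x i * x j) -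
      1 / (n + 1) * ((x i ^ 2 + x j ^ 2) / 2) ≤ x i * (S i j * x j) := by
    intro i j
    have h1 : |(S i j - (1 : Matrix (Fin n) (Fin n) ℝ) i j) * (x i * x j)| ≤
        1 / (n + 1) * ((x i ^ 2 + x j ^ 2) / 2) := by
      rw [abs_mul]
      refine mul_le_mul (hS i j) ?_ (abs_nonneg _) (by positivity)
      rw [abs_le]
      constructor <;> nlinarith [sq_nonneg (x i + x j), sq_nonneg (x i - x j)]
    have := (abs_le.1 h1).1
    linarith
  have hsum := Finset.sum_le_sum fun i (_ : i ∈ Finset.univ) =>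
    Finset.sum_le_sum fun j (_ : j ∈ Finset.univ) => hterm i j
  have hl : ∑ i, ∑ j, ((1 : Matrix (Fin n) (Fin n) ℝ) i j * (x i * x j) -
      1 / (n + 1) * ((x i ^ 2 + x j ^ 2) / 2)) = 1 / (n + 1) * ∑ i, x i ^ 2 := by
    simp only [Finset.sum_sub_distrib, Matrix.one_apply, ite_mul, one_mul, zero_mul,
      Finset.sum_ite_eq, Finset.mem_univ, if_true, ← Finset.mul_sum, ← Finset.sum_div,
      Finset.sum_add_distrib, Finset.sum_const, Finset.card_univ, Fintype.card_fin, nsmul_eq_mul]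
    have : (n + 1 : ℝ) ≠ 0 := by positivity
    field_simp
    ring
  rw [hl] at hsum
  refine lt_of_lt_of_le (mul_pos (by positivity) hpos) (hsum.trans_eq ?_)
  simp [dotProduct, Matrix.mulVec, Finset.mul_sum]

open scoped MatrixOrder Matrix.Norms.L2Operator ComplexOrder in
lemma posDef_map_ofReal {ι : Type*} [Fintype ι] [DecidableEq ι] {S : Matrix ι ι ℝ}
    (hS : S.PosDef) : (S.map ((↑) : ℝ → ℂ)).PosDef := by
  obtain ⟨B, hB⟩ := CStarAlgebra.nonneg_iff_eq_star_mul_self.1 hS.posSemidef.nonneg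
  have hmap : S.map ((↑) : ℝ → ℂ) =
      (B.map ((↑) : ℝ → ℂ)).conjTranspose * B.map ((↑) : ℝ → ℂ) := by
    ext i j
    simp [hB, Matrix.mul_apply, Matrix.star_eq_conjTranspose]
  have hpsd : (S.map ((↑) : ℝ → ℂ)).PosSemidef := by
    rw [hmap]; exact Matrix.posSemidef_conjTranspose_mul_self _
  refine hpsd.posDef_iff_isUnit.2 ?_
  exact hS.isUnit.map (Complex.ofRealHom.mapMatrix)

variable {G : Digraph (Fin n)} (hG : IsAcyclic G)

lemma exists_real_of_mem_locHat {τ : HatPoint n} (hτ : τ ∈ locHat G) :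
    ∃ l : Edge G → ℝ, τ = paramPoint G hG fun e => (l e : ℂ) := by
  obtain ⟨S, -, ⟨L, hL⟩, hS⟩ := (mem_loc_iff hG).1 hτ
  refine ⟨_, eq_paramPoint hG (L := fun i k => (L i k : ℂ)) fun i j hj => ?_⟩
  simp only [symMatrix, Matrix.of_apply, hS]
  rw [hL i j hj]
  push_cast
  rfl

lemma continuous_paramPoint (e : OffDiag n) :
    Continuous fun l : Edge G → ℝ => paramPoint G hG l e := by
  have : (fun l : Edge G → ℝ => paramPoint G hG l e) = fun l =>
      eval l (paramPoint G hG (X : Edge G → MvPolynomial (Edge G) ℝ) e) := by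
    funext l
    rw [map_paramPoint]
    simp
  rw [this]
  exact MvPolynomial.continuous_eval _

lemma paramPoint_mem_of_abs_le {l : Edge G → ℝ}
    (hl : ∀ e, |paramPoint G hG l e| ≤ 1 / (n + 1)) :
    paramPoint G hG (fun e => (l e : ℂ)) ∈ locHat G ∩ hatPosDef n := by
  let S : Matrix (Fin n) (Fin n) ℝ := symMatrix (unitDiag (paramPoint G hG l))
  have hS : S.PosDef := by
    refine posDef_of_abs_le (symMatrix_comm _) fun i j => ?_
    by_cases h : i = j
    · subst h
      simp only [S, symMatrix_unitDiag_self, Matrix.one_apply_eq, sub_self, abs_zero]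
      positivity
    · simpa [S, symMatrix, unitDiag, h] using hl ⟨s(i, j), by simpa using h⟩
  have hcast : ∀ i j, unitDiag (paramPoint G hG fun e => (l e : ℂ)) s(i, j) = (S i j : ℂ) :=
    fun i j => by
      change symMatrix (unitDiag (paramPoint G hG fun e => (l e : ℂ))) i j = _
      simp only [S, symMatrix_paramPoint]
      rw [← Complex.ofRealHom_eq_coe, map_param]
      simp_rw [map_edgeCoeff]
      rfl
  refine ⟨(mem_loc_iff hG).2 ⟨S, hS.posSemidef, ⟨_, hasRegression_paramPoint hG l⟩, hcast⟩, ?_⟩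
  have : symMatrix (unitDiag (paramPoint G hG fun e => (l e : ℂ))) = S.map ((↑) : ℝ → ℂ) :=
    Matrix.ext hcast
  rw [hatPosDef, Set.mem_ofPred_eq, this]
  exact posDef_map_ofReal hS

lemma exists_box : ∃ δ > (0 : ℝ), ∀ l : Edge G → ℝ, (∀ e, |l e| < δ) →
    paramPoint G hG (fun e => (l e : ℂ)) ∈ locHat G ∩ hatPosDef n := by
  let := Fintype.ofFinite (Edge G)
  have hev : ∀ᶠ l : Edge G → ℝ in nhds 0, ∀ e, |paramPoint G hG l e| < (1 / (n + 1) : ℝ) := by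
    refine Filter.eventually_all.2 fun e => ?_
    have hc := (continuous_paramPoint hG e).abs.tendsto (0 : Edge G → ℝ)
    refine hc.eventually_lt_const ?_
    rw [paramPoint_zero]
    simp only [Pi.zero_apply, abs_zero]
    positivity
  obtain ⟨δ, hδ, hball⟩ := Metric.eventually_nhds_iff.1 hev
  refine ⟨δ, hδ, fun l hl => paramPoint_mem_of_abs_le hG fun e => (hball ?_ e).le⟩
  exact (dist_pi_lt_iff hδ).2 fun e => by simpa [Real.dist_eq] using hl e

/-- The pullback of regular functions along the parametrization by regression coefficients. -/
def paramHom (G : Digraph (Fin n)) (hG : IsAcyclic G) :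
    MvPolynomial (OffDiag n) ℂ →ₐ[ℂ] MvPolynomial (Edge G) ℂ :=
  aeval (paramPoint G hG X)

lemma aeval_paramPoint {R : Type*} [CommRing R] [Algebra ℂ R] (l : Edge G → R)
    (f : MvPolynomial (OffDiag n) ℂ) :
    aeval (paramPoint G hG l) f = aeval l (paramHom G hG f) := by
  have : aeval (paramPoint G hG l) = (aeval l).comp (paramHom G hG) := by
    refine MvPolynomial.algHom_ext fun e => ?_
    simp only [aeval_X, AlgHom.comp_apply, paramHom]
    rw [map_paramPoint]
    simp
  rw [this]; rfl

/-- The pullback of f vanishes on a product of infinite sets, the real box, and is therefore the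
zero polynomial. -/
lemma vanishingIdeal_posDef_le :
    vanishingIdeal ℂ (locHat G ∩ hatPosDef n) ≤ RingHom.ker (paramHom G hG) := by
  intro f hf
  obtain ⟨δ, hδ, hbox⟩ := exists_box hG
  refine RingHom.mem_ker.2 (funext_set (fun _ => (fun x : ℝ => (x : ℂ)) '' Set.Ioo (-δ) δ)
    (fun _ => (Set.Ioo_infinite (by linarith)).image Complex.ofReal_injective.injOn)
    fun x hx => ?_)
  choose l hl hlx using fun e => hx e (Set.mem_univ e)
  obtain rfl : (fun e => (l e : ℂ)) = x := funext hlx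
  rw [map_zero, ← aeval_eq_eval, ← aeval_paramPoint]
  exact hf _ (hbox l fun e => abs_lt.2 (hl e))

lemma ker_paramHom_le : RingHom.ker (paramHom G hG) ≤ vanishingIdeal ℂ (locHat G) := by
  intro f hf τ hτ
  obtain ⟨l, rfl⟩ := exists_real_of_mem_locHat hG hτ
  rw [aeval_paramPoint, RingHom.mem_ker.1 hf, map_zero]

lemma vanishingIdeal_locHat : vanishingIdeal ℂ (locHat G) = RingHom.ker (paramHom G hG) :=
  le_antisymm ((vanishingIdeal_anti_mono Set.inter_subset_left).trans (vanishingIdeal_posDef_le hG))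
    (ker_paramHom_le hG)

lemma vanishingIdeal_posDef :
    vanishingIdeal ℂ (locHat G ∩ hatPosDef n) = RingHom.ker (paramHom G hG) :=
  le_antisymm (vanishingIdeal_posDef_le hG)
    ((ker_paramHom_le hG).trans (vanishingIdeal_anti_mono Set.inter_subset_left))

lemma vanishingIdeal_zariskiClosure {ι : Type*} (S : Set (ι → ℂ)) :
    vanishingIdeal ℂ (zariskiClosure S) = vanishingIdeal ℂ S :=
  le_antisymm (vanishingIdeal_anti_mono (zeroLocus_vanishingIdeal_le S))
    (le_vanishingIdeal_zeroLocus _)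

lemma vanishingIdeal_varietyHat :
    vanishingIdeal ℂ (varietyHat G) = RingHom.ker (paramHom G hG) := by
  rw [varietyHat, vanishingIdeal_zariskiClosure, vanishingIdeal_locHat hG]

lemma paramPoint_mem_varietyHat (l : Edge G → ℂ) : paramPoint G hG l ∈ varietyHat G := by
  rw [varietyHat, zariskiClosure, vanishingIdeal_locHat hG]
  intro f hf
  rw [aeval_paramPoint, RingHom.mem_ker.1 hf, map_zero]

end

/-! ### Irreducibility, the zero set and the saturation. -/

section

variable {n : ℕ} {G : Digraph (Fin n)} (hG : IsAcyclic G)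

include hG in
lemma isPrime_vanishingIdeal : (vanishingIdeal ℂ (varietyHat G)).IsPrime := by
  rw [vanishingIdeal_varietyHat hG]
  exact RingHom.ker_isPrime _

include hG in
lemma isIrreducibleVariety_varietyHat : IsIrreducibleVariety (varietyHat G) := by
  refine ⟨⟨_, rfl⟩, ⟨_, paramPoint_mem_varietyHat hG 0⟩, ?_⟩
  rintro _ _ ⟨I, rfl⟩ ⟨J, rfl⟩ hIJ
  by_contra! h
  obtain ⟨x, hx, hxI⟩ := Set.not_subset.1 h.1
  obtain ⟨y, hy, hyJ⟩ := Set.not_subset.1 h.2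
  simp only [mem_zeroLocus_iff, not_forall] at hxI hyJ
  obtain ⟨f, hf, hfx⟩ := hxI
  obtain ⟨g, hg, hgy⟩ := hyJ
  have hfg : f * g ∈ vanishingIdeal ℂ (varietyHat G) := fun z hz => by
    rcases hIJ hz with hz | hz
    · rw [map_mul, hz f hf, zero_mul]
    · rw [map_mul, hz g hg, mul_zero]
  rcases (isPrime_vanishingIdeal hG).mem_or_mem hfg with h | h
  · exact hfx (h x hx)
  · exact hgy (h y hy)

lemma aeval_zero_thetaHat : aeval (0 : HatPoint n) (thetaHat n) = 1 := by
  have h1 : symMatrix (unitDiag (0 : HatPoint n)) = 1 := by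
    ext i j
    by_cases h : i = j <;> simp [symMatrix, unitDiag, h, Matrix.one_apply]
  rw [thetaHat, map_prod]
  refine Finset.prod_eq_one fun A _ => ?_
  rw [aeval_principalMinor, h1, principalMinor,
    Matrix.submatrix_one _ Subtype.val_injective, Matrix.det_one]

/-- At coefficients 0 the matrix is the identity, where all principal minors are 1. -/
lemma paramHom_thetaHat_ne_zero : paramHom G hG (thetaHat n) ≠ 0 := by
  intro h
  have := aeval_paramPoint hG (0 : Edge G → ℂ) (thetaHat n)
  rw [paramPoint_zero, aeval_zero_thetaHat, h, map_zero] at this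
  exact one_ne_zero this

lemma paramHom_eq_zero_of_mem {f : MvPolynomial (OffDiag n) ℂ} (hf : f ∈ idealHat G) :
    paramHom G hG f = 0 :=
  aeval_paramPoint_eq_zero hG X hf

include hG in
lemma zeroLocus_idealHat :
    zeroLocus ℂ (idealHat G) = varietyHat G ∪ zeroLocus ℂ (idealHat G ⊔ Ideal.span {thetaHat n}) := by
  refine Set.Subset.antisymm (fun τ hτ => ?_) (Set.union_subset (fun τ hτ f hf => ?_) ?_)
  · by_cases h : aeval τ (thetaHat n) = 0
    · right
      have hle : idealHat G ⊔ Ideal.span {thetaHat n} ≤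
          RingHom.ker (aeval τ : MvPolynomial (OffDiag n) ℂ →ₐ[ℂ] ℂ) :=
        sup_le (fun f hf => hτ f hf) (by simpa [Ideal.span_le] using h)
      exact fun f hf => hle hf
    · left
      obtain ⟨l, rfl⟩ := exists_eq_paramPoint hG (isUnit_iff_ne_zero.2 h) hτ
      exact paramPoint_mem_varietyHat hG l
  · have : f ∈ vanishingIdeal ℂ (varietyHat G) := by
      rw [vanishingIdeal_varietyHat hG]
      exact paramHom_eq_zero_of_mem hG hf
    exact this τ hτ
  · exact zeroLocus_anti_mono le_sup_left

/-- A polynomial that vanishes on the variety vanishes at every point, with coordinates in a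
`ℂ`-algebra, at which the imposed relations hold and the principal minors are invertible. -/
lemma aeval_eq_zero_of_isUnit {R : Type*} [CommRing R] [Algebra ℂ R] {c : OffDiag n → R}
    (hθ : IsUnit (aeval c (thetaHat n))) (hI : ∀ f ∈ idealHat G, aeval c f = 0)
    {f : MvPolynomial (OffDiag n) ℂ} (hf : paramHom G hG f = 0) : aeval c f = 0 := by
  obtain ⟨l, rfl⟩ := exists_eq_paramPoint hG hθ hI
  rw [aeval_paramPoint, hf, map_zero]

include hG in
lemma vanishingIdeal_eq_saturation :
    vanishingIdeal ℂ (varietyHat G) = saturation (idealHat G) (thetaHat n) := by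
  rw [vanishingIdeal_varietyHat hG]
  refine le_antisymm (fun f hf => ?_) (fun f hf => ?_)
  -- The classes of the coordinates in T / J are the universal point at which the imposed relations
  -- hold and θ is invertible; f vanishes there, so f lies in J.
  · let T := Localization.Away (thetaHat n)
    let J := (idealHat G).map (algebraMap (MvPolynomial (OffDiag n) ℂ) T)
    let q : MvPolynomial (OffDiag n) ℂ →ₐ[ℂ] T ⧸ J :=
      (Ideal.Quotient.mkₐ ℂ J).comp (IsScalarTower.toAlgHom ℂ (MvPolynomial (OffDiag n) ℂ) T)
    have hq : aeval (fun e => q (X e)) = q := (aeval_unique q).symm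
    have hθ : IsUnit (q (thetaHat n)) :=
      (IsLocalization.Away.algebraMap_isUnit (S := T) (thetaHat n)).map (Ideal.Quotient.mk J)
    have hI : ∀ g ∈ idealHat G, q g = 0 := fun g hg =>
      Ideal.Quotient.eq_zero_iff_mem.2 (Ideal.mem_map_of_mem _ hg)
    rw [← hq] at hθ hI
    have := aeval_eq_zero_of_isUnit hG hθ hI (RingHom.mem_ker.1 hf)
    rw [hq] at this
    exact Ideal.mem_comap.2 (Ideal.Quotient.eq_zero_iff_mem.1 this)
  -- Since θ pulls back to a nonzero polynomial, φ* extends to the localization at θ with values in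
  -- a field, and the extension kills the imposed ideal.
  · let K := FractionRing (MvPolynomial (Edge G) ℂ)
    let ψ : MvPolynomial (OffDiag n) ℂ →+* K :=
      (algebraMap (MvPolynomial (Edge G) ℂ) K).comp (paramHom G hG).toRingHom
    have hψ : ∀ g, ψ g = 0 ↔ paramHom G hG g = 0 := fun g =>
      map_eq_zero_iff _ (IsFractionRing.injective (MvPolynomial (Edge G) ℂ) K)
    have hu : IsUnit (ψ (thetaHat n)) :=
      isUnit_iff_ne_zero.2 fun h => paramHom_thetaHat_ne_zero hG ((hψ _).1 h)
    let Ψ : Localization.Away (thetaHat n) →+* K := IsLocalization.Away.lift (thetaHat n) hu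
    have hΨ : ∀ g, Ψ (algebraMap _ _ g) = ψ g := fun g => IsLocalization.Away.lift_eq _ hu g
    have hle : (idealHat G).map (algebraMap _ (Localization.Away (thetaHat n))) ≤
        RingHom.ker Ψ := by
      refine Ideal.map_le_iff_le_comap.2 fun g hg => ?_
      rw [Ideal.mem_comap, RingHom.mem_ker, hΨ, hψ]
      exact paramHom_eq_zero_of_mem hG hg
    have := RingHom.mem_ker.1 (hle (Ideal.mem_comap.1 hf))
    rw [hΨ, hψ] at this
    exact this

end

/-! ### Rationality, dimension and smoothness. -/

section

variable {n : ℕ} {G : Digraph (Fin n)} (hG : IsAcyclic G)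

include hG in
lemma isDomain_coordRing : IsDomain (CoordRing (varietyHat G)) :=
  (Ideal.Quotient.isDomain_iff_prime _).2 (isPrime_vanishingIdeal hG)

/-- The embedding of the coordinate ring into the ring of polynomials in the regression
coefficients. -/
def coordHom : CoordRing (varietyHat G) →ₐ[ℂ] MvPolynomial (Edge G) ℂ :=
  Ideal.Quotient.liftₐ _ (paramHom G hG) fun _ hf =>
    RingHom.mem_ker.1 ((vanishingIdeal_varietyHat hG).le hf)

@[simp] lemma coordHom_mk (f : MvPolynomial (OffDiag n) ℂ) :
    coordHom hG (Ideal.Quotient.mk _ f) = paramHom G hG f := rfl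

lemma coordHom_injective : Function.Injective (coordHom hG) := by
  refine (injective_iff_map_eq_zero _).2 fun a ha => ?_
  obtain ⟨f, rfl⟩ := Ideal.Quotient.mk_surjective a
  exact Ideal.Quotient.eq_zero_iff_mem.2 ((vanishingIdeal_varietyHat hG).ge ha)

variable (G) in
/-- The product of the principal minors as a regular function on the variety. -/
abbrev coordTheta : CoordRing (varietyHat G) := Ideal.Quotient.mk _ (thetaHat n)

include hG in
lemma coordTheta_ne_zero : coordTheta G ≠ 0 := fun h =>
  paramHom_thetaHat_ne_zero hG (by simpa using congrArg (coordHom hG) h)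

lemma aeval_algHom_coord {R : Type*} [CommRing R] [Algebra ℂ R]
    (q : CoordRing (varietyHat G) →ₐ[ℂ] R) (f : MvPolynomial (OffDiag n) ℂ) :
    aeval (fun e => q (Ideal.Quotient.mk _ (X e))) f = q (Ideal.Quotient.mk _ f) := by
  have : aeval (fun e => q (Ideal.Quotient.mk _ (X e))) = q.comp (Ideal.Quotient.mkₐ ℂ _) :=
    MvPolynomial.algHom_ext fun e => by simp
  rw [this]; rfl

/-- The regression coefficients are regular functions where the principal minors are invertible. -/
lemma exists_coeff_of_isUnit {R : Type*} [CommRing R] [Algebra ℂ R]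
    (q : CoordRing (varietyHat G) →ₐ[ℂ] R) (hθ : IsUnit (q (coordTheta G))) :
    ∃ l : Edge G → R, (fun e => q (Ideal.Quotient.mk _ (X e))) = paramPoint G hG l := by
  refine exists_eq_paramPoint hG (by rwa [aeval_algHom_coord]) fun f hf => ?_
  rw [aeval_algHom_coord, Ideal.Quotient.eq_zero_iff_mem.2, map_zero]
  exact (vanishingIdeal_varietyHat hG).ge (paramHom_eq_zero_of_mem hG hf)

/-- Two points with the same image under the parametrization, where the principal minors are
invertible: the comparison map recovers the regression coefficients. -/
lemma map_coeff_eq {R S : Type*} [CommRing R] [Algebra ℂ R] [CommRing S] [Algebra ℂ S]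
    {q : CoordRing (varietyHat G) →ₐ[ℂ] R} {l : Edge G → R}
    (hl : (fun e => q (Ideal.Quotient.mk _ (X e))) = paramPoint G hG l) (f : R →ₐ[ℂ] S)
    (j : MvPolynomial (Edge G) ℂ →ₐ[ℂ] S) (hfj : f.comp q = j.comp (coordHom hG))
    (hθ : IsUnit (j (paramHom G hG (thetaHat n)))) (e : Edge G) : f (l e) = j (X e) := by
  have h1 : paramPoint G hG (fun e => j (X e)) = paramPoint G hG fun e => f (l e) := by
    funext e
    rw [← map_paramPoint, ← map_paramPoint, ← hl]
    have h2 := DFunLike.congr_fun hfj (Ideal.Quotient.mk _ (X e))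
    simp only [AlgHom.comp_apply, coordHom_mk, paramHom, aeval_X] at h2
    exact h2.symm
  have h3 : IsUnit (aeval (paramPoint G hG fun e => j (X e)) (thetaHat n)) := by
    rw [aeval_paramPoint]
    rwa [show aeval (fun e => j (X e)) = j from (aeval_unique j).symm]
  exact (congrFun (paramPoint_injective_of_isUnit hG h3 h1) e).symm

include hG in
-- θ is invertible in the function field, so the coefficients are rational functions on the variety
-- and invert φ* birationally.
lemma nonempty_fractionRing_equiv :
    Nonempty (FractionRing (CoordRing (varietyHat G)) ≃ₐ[ℂ]
      FractionRing (MvPolynomial (Edge G) ℂ)) := by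
  have := isDomain_coordRing hG
  obtain ⟨l, hl⟩ := exists_coeff_of_isUnit hG
    (IsScalarTower.toAlgHom ℂ _ (FractionRing (CoordRing (varietyHat G))))
    (isUnit_iff_ne_zero.2 ((map_ne_zero_iff _ (IsFractionRing.injective _ _)).2
      (coordTheta_ne_zero hG)))
  refine nonempty_fractionField_algEquiv (coordHom_injective hG) (aeval l) fun f hf =>
    MvPolynomial.algHom_ext fun e => ?_
  rw [AlgHom.comp_apply, aeval_X]
  exact map_coeff_eq hG hl f _ hf (isUnit_iff_ne_zero.2
    ((map_ne_zero_iff _ (IsFractionRing.injective _ _)).2 (paramHom_thetaHat_ne_zero hG))) e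

include hG in
lemma isRational_varietyHat : IsRational (varietyHat G) := by
  obtain ⟨e⟩ := nonempty_fractionRing_equiv hG
  refine ⟨Nat.card (Edge G), ⟨e.trans ?_⟩⟩
  exact IsFractionRing.algEquivOfAlgEquiv (renameEquiv ℂ (Finite.equivFin (Edge G)))

include hG in
lemma hasDimension_varietyHat : HasDimension (varietyHat G) (numEdges G) := by
  have := isDomain_coordRing hG
  obtain ⟨e⟩ := nonempty_fractionRing_equiv hG
  have h1 := trdeg_add_eq ℂ (CoordRing (varietyHat G))
    (A := FractionRing (CoordRing (varietyHat G)))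
  have h2 := trdeg_add_eq ℂ (MvPolynomial (Edge G) ℂ)
    (A := FractionRing (MvPolynomial (Edge G) ℂ))
  have halg : ∀ (R : Type) [CommRing R] [IsDomain R], Algebra.trdeg R (FractionRing R) = 0 :=
    fun R _ _ => by
      have : Algebra.IsAlgebraic R (FractionRing R) :=
        IsLocalization.isAlgebraic _ (nonZeroDivisors R)
      exact trdeg_eq_zero
  rw [halg, add_zero] at h1 h2
  refine ringKrullDim_eq_of_trdeg_eq (k := ℂ) ?_
  rw [h1, e.trdeg_eq, ← h2, MvPolynomial.trdeg_of_isDomain, Cardinal.lift_id, numEdges]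
  exact (Nat.cast_card (α := Edge G)).symm

include hG in
lemma formallySmooth_away_coordTheta :
    Algebra.FormallySmooth ℂ (Localization.Away (coordTheta G)) := by
  obtain ⟨l, hl⟩ := exists_coeff_of_isUnit hG
    (IsScalarTower.toAlgHom ℂ _ (Localization.Away (coordTheta G)))
    (IsLocalization.Away.algebraMap_isUnit _)
  have hloc : IsLocalization.Away (coordHom hG (coordTheta G))
    (Localization.Away (paramHom G hG (thetaHat n))) := Localization.isLocalization
  refine formallySmooth_away (θ := coordTheta G)
    (U := Localization.Away (paramHom G hG (thetaHat n)))
    (coordHom hG) (aeval l) ?_ fun f hf =>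
    MvPolynomial.algHom_ext fun e => ?_
  · refine Ideal.Quotient.algHom_ext _ (MvPolynomial.algHom_ext fun e => ?_)
    change aeval l (paramHom G hG (X e)) = _
    rw [← aeval_paramPoint, aeval_X, ← hl]
    rfl
  · rw [AlgHom.comp_apply, aeval_X]
    exact map_coeff_eq hG hl f _ hf (IsLocalization.Away.algebraMap_isUnit _) e

include hG in
lemma isSmoothAtPoint_varietyHat (τ : varietyHat G)
    (hτ : ∀ A : Finset (Fin n), principalMinor (symMatrix (unitDiag τ.1)) A ≠ 0) :
    IsSmoothAtPoint (varietyHat G) τ := by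
  have : Algebra.FinitePresentation ℂ (CoordRing (varietyHat G)) :=
    Algebra.FinitePresentation.of_finiteType.1 inferInstance
  -- Away from θ the variety is isomorphic to an open subset of affine space.
  have hsub := Algebra.basicOpen_subset_smoothLocus_iff.2 (formallySmooth_away_coordTheta hG)
  have hprime : (RingHom.ker (evalAt (varietyHat G) τ)).IsPrime := RingHom.ker_isPrime _
  refine hsub (a := ⟨_, hprime⟩) ?_
  have heval : evalAt (varietyHat G) τ (coordTheta G) = aeval τ.1 (thetaHat n) := rfl
  rw [SetLike.mem_coe, PrimeSpectrum.mem_basicOpen, RingHom.mem_ker, heval, thetaHat, map_prod]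
  refine Finset.prod_ne_zero_iff.2 fun A _ => ?_
  rw [aeval_principalMinor]
  exact hτ A

end

/-! ### Normalizing the diagonal. -/

section

variable {n : ℕ} {G : Digraph (Fin n)} (hG : IsAcyclic G)

/-- A multi-affine polynomial function that vanishes on a box with at least two points in each
direction has coefficients that add up to zero. -/
lemma sum_coeff_eq_zero_of_box {α : Type*} (s : Finset α) (c : α → ℂ) (m : α → Fin n → ℕ)
    (hm : ∀ a i, m a i ≤ 1) (S : Fin n → Finset ℂ) (hS : ∀ i, 1 < (S i).card)
    (h : ∀ x : Fin n → ℂ, (∀ i, x i ∈ S i) → ∑ a ∈ s, c a * ∏ i, x i ^ m a i = 0) :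
    ∑ a ∈ s, c a = 0 := by
  let Q : MvPolynomial (Fin n) ℂ :=
    ∑ a ∈ s, monomial (Finsupp.equivFunOnFinite.symm (m a)) (c a)
  have heval : ∀ x, eval x Q = ∑ a ∈ s, c a * ∏ i, x i ^ m a i := fun x => by
    simp [Q, eval_monomial, Finsupp.prod_fintype]
  -- The degree in each variable is at most 1, below the number of grid points; evaluating Q = 0 at
  -- (1, ..., 1) gives the sum of the coefficients.
  have hQ : Q = 0 := by
    refine MvPolynomial.eq_zero_of_eval_zero_at_prod_finset Q S (fun i => ?_)
      fun x hx => (heval x).trans (h x hx)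
    refine lt_of_le_of_lt ((degreeOf_sum_le i s _).trans (Finset.sup_le fun a _ => ?_)) (hS i)
    by_cases hc : c a = 0
    · simp [hc]
    · rw [degreeOf_monomial_eq _ _ hc]
      exact hm a i
  have := heval 1
  rw [hQ, map_zero] at this
  simpa using this.symm

/-- The product of the entries of `u` at the two ends of a pair. -/
def pairWeight {R : Type*} [CommMonoid R] (u : Fin n → R) (e : Sym2 (Fin n)) : R :=
  Sym2.lift ⟨fun i j => u i * u j, fun _ _ => mul_comm _ _⟩ e

lemma pairWeight_eq_prod {R : Type*} [CommMonoid R] (u : Fin n → R) {e : Sym2 (Fin n)}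
    (he : ¬ e.IsDiag) : pairWeight u e = ∏ i, u i ^ (if i ∈ e then 1 else 0) := by
  induction e with
  | _ i j =>
  have hij : i ≠ j := by simpa using he
  rw [← Finset.prod_subset (Finset.subset_univ {i, j}), Finset.prod_pair hij]
  · simp [pairWeight]
  · intro k _ hk
    have : k ∉ s(i, j) := by simpa using hk
    simp [this]

include hG in
-- Replacing X_i by u_i X_i turns λ_ik into u_i λ_ik / u_k.
lemma scale_mem_loc {s : SymPoint n} (hs : s ∈ loc G) (u : Fin n → ℝ) (hu : ∀ i, u i ≠ 0) :
    (fun e => s e * pairWeight (fun i => (u i : ℂ)) e) ∈ loc G := by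
  obtain ⟨S, hS, ⟨L, hL⟩, hSs⟩ := (mem_loc_iff hG).1 hs
  refine (mem_loc_iff hG).2 ⟨(Matrix.diagonal u).conjTranspose * S * Matrix.diagonal u,
    hS.conjTranspose_mul_mul_same _, ⟨fun i k => u i * L i k / u k, fun i j hj => ?_⟩,
    fun i j => ?_⟩
  · simp only [Matrix.diagonal_conjTranspose, Matrix.mul_diagonal, Matrix.diagonal_mul,
      star_trivial, hL i j hj, Finset.mul_sum, Finset.sum_mul]
    refine Finset.sum_congr rfl fun k _ => ?_
    have := hu k
    field_simp
  · simp only [Matrix.diagonal_conjTranspose, Matrix.mul_diagonal, Matrix.diagonal_mul,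
      star_trivial, hSs, pairWeight, Sym2.lift_mk]
    push_cast
    ring

/-- The degree of a monomial in the coordinates of row `i`. -/
def rowDegree (a : OffDiag n →₀ ℕ) (i : Fin n) : ℕ :=
  ∑ e : OffDiag n, (if i ∈ e.1 then 1 else 0) * a e

lemma prod_pairWeight_pow {R : Type*} [CommMonoid R] (u : Fin n → R) (a : OffDiag n →₀ ℕ) :
    ∏ e : OffDiag n, pairWeight u e.1 ^ a e = ∏ i, u i ^ rowDegree a i := by
  simp_rw [fun e : OffDiag n => pairWeight_eq_prod u e.2, ← Finset.prod_pow, ← pow_mul]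
  rw [Finset.prod_comm]
  simp_rw [Finset.prod_pow_eq_pow_sum]
  rfl

/-- A polynomial on the space of symmetric matrices that agrees with `f` on the matrices with ones
on the diagonal and corresponds to `f` under normalization of the diagonal. -/
def homogenization (f : MvPolynomial (OffDiag n) ℂ) : MvPolynomial (Sym2 (Fin n)) ℂ :=
  ∑ a ∈ f.support, C (f.coeff a) * (∏ e : OffDiag n, X e.1 ^ a e) *
    ∏ i, X s(i, i) ^ ((∑ b ∈ f.support, rowDegree b i) - rowDegree a i / 2)

lemma aeval_homogenization (f : MvPolynomial (OffDiag n) ℂ) (s : SymPoint n) :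
    aeval s (homogenization f) = ∑ a ∈ f.support, f.coeff a * (∏ e : OffDiag n, s e.1 ^ a e) *
      ∏ i, s s(i, i) ^ ((∑ b ∈ f.support, rowDegree b i) - rowDegree a i / 2) := by
  simp [homogenization]

lemma aeval_homogenization_unitDiag (f : MvPolynomial (OffDiag n) ℂ) (τ : HatPoint n) :
    aeval (unitDiag τ) (homogenization f) = aeval τ f := by
  rw [aeval_homogenization, aeval_eq_eval, eval_eq']
  refine Finset.sum_congr rfl fun a _ => ?_
  have h1 : ∀ i, unitDiag τ s(i, i) = 1 := symMatrix_unitDiag_self τ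
  have h2 : ∀ e : OffDiag n, unitDiag τ e.1 = τ e := fun e => by simp [unitDiag, e.2]
  simp [h1, h2]

include hG in
-- For u_i = ±σ_ii^(-1/2) the rescaled matrix lies in the model, so f vanishes at it. For row degree
-- d, u_i^d = σ_ii^(-⌊d/2⌋) u_i^(d mod 2), so up to a common factor this value is multi-affine in u,
-- with coefficients the terms of `homogenization f` at s. It vanishes for all choices of signs, so
-- the terms add up to zero.
lemma aeval_homogenization_eq_zero {f : MvPolynomial (OffDiag n) ℂ}
    (hf : f ∈ vanishingIdeal ℂ (locHat G)) {s : SymPoint n} (hs : s ∈ loc G)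
    (hpos : ∀ i, s s(i, i) ≠ 0) : aeval s (homogenization f) = 0 := by
  obtain ⟨S, hS, -, hSs⟩ := (mem_loc_iff hG).1 hs
  have hSpos : ∀ i, 0 < S i i := fun i => lt_of_le_of_ne hS.diag_nonneg fun h =>
    hpos i (by rw [hSs, ← h, Complex.ofReal_zero])
  let r : Fin n → ℝ := fun i => (Real.sqrt (S i i))⁻¹
  have hr : ∀ i, r i ≠ 0 := fun i => inv_ne_zero (Real.sqrt_pos.2 (hSpos i)).ne'
  have hr2 : ∀ i, r i ^ 2 * S i i = 1 := fun i => by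
    rw [inv_pow, Real.sq_sqrt (hSpos i).le, inv_mul_cancel₀ (hSpos i).ne']
  let N : Fin n → ℕ := fun i => ∑ b ∈ f.support, rowDegree b i
  rw [aeval_homogenization]
  refine sum_coeff_eq_zero_of_box f.support _ (fun a i => rowDegree a i % 2)
    (fun a i => Nat.lt_succ_iff.1 (Nat.mod_lt _ two_pos)) (fun i => {(r i : ℂ), -(r i : ℂ)})
    (fun i => ?_) fun x hx => ?_
  · rw [Finset.card_pair]
    · exact one_lt_two
    · intro h
      exact hr i (by simpa using self_eq_neg.1 h)
  obtain ⟨u, rfl, hu⟩ : ∃ u : Fin n → ℝ, x = (fun i => (u i : ℂ)) ∧ ∀ i, u i ^ 2 * S i i = 1 := by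
    have : ∀ i, ∃ v : ℝ, x i = v ∧ v ^ 2 * S i i = 1 := fun i => by
      rcases Finset.mem_insert.1 (hx i) with h | h
      · exact ⟨r i, h, hr2 i⟩
      · exact ⟨-r i, by simpa using h, by simpa using hr2 i⟩
    choose u h1 h2 using this
    exact ⟨u, funext h1, h2⟩
  have hu0 : ∀ i, u i ≠ 0 := fun i h => by simpa [h] using hu i
  have hsu : ∀ i, s s(i, i) * (u i : ℂ) ^ 2 = 1 := fun i => by
    rw [hSs, mul_comm]
    exact_mod_cast hu i
  let τ : HatPoint n := fun e => s e.1 * pairWeight (fun i => (u i : ℂ)) e.1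
  have hτ : τ ∈ locHat G := by
    have hmem := scale_mem_loc hG hs u hu0
    have : unitDiag τ = fun e => s e * pairWeight (fun i => (u i : ℂ)) e := by
      funext e
      by_cases he : e.IsDiag
      · induction e with
        | _ i j =>
        obtain rfl : i = j := by simpa using he
        simp only [unitDiag, he, dif_pos, pairWeight, Sym2.lift_mk]
        rw [← sq, hsu]
      · simp [unitDiag, he, τ]
    rw [locHat, Set.mem_ofPred_eq, this]
    exact hmem
  have hτf := hf τ hτ
  rw [aeval_eq_eval, eval_eq'] at hτf
  have hterm : ∀ a ∈ f.support, f.coeff a * (∏ e : OffDiag n, s e.1 ^ a e) *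
      (∏ i, s s(i, i) ^ ((∑ b ∈ f.support, rowDegree b i) - rowDegree a i / 2)) *
      ∏ i, (u i : ℂ) ^ (rowDegree a i % 2) =
      (∏ i, s s(i, i) ^ N i) * (f.coeff a * ∏ e, τ e ^ a e) := by
    intro a ha
    have h1 : ∏ e, τ e ^ a e =
        (∏ e : OffDiag n, s e.1 ^ a e) * ∏ i, (u i : ℂ) ^ rowDegree a i := by
      rw [← prod_pairWeight_pow, ← Finset.prod_mul_distrib]
      exact Finset.prod_congr rfl fun e _ => mul_pow _ _ _
    have h2 : (∏ i, s s(i, i) ^ (N i - rowDegree a i / 2)) *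
        ∏ i, (u i : ℂ) ^ (rowDegree a i % 2) =
        (∏ i, s s(i, i) ^ N i) * ∏ i, (u i : ℂ) ^ rowDegree a i := by
      rw [← Finset.prod_mul_distrib, ← Finset.prod_mul_distrib]
      refine Finset.prod_congr rfl fun i _ => ?_
      have hle : rowDegree a i ≤ N i :=
        Finset.single_le_sum (f := fun b => rowDegree b i) (fun _ _ => Nat.zero_le _) ha
      have hN : s s(i, i) ^ N i =
          s s(i, i) ^ (N i - rowDegree a i / 2) * s s(i, i) ^ (rowDegree a i / 2) := by
        rw [← pow_add]; congr 1; omega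
      have hd : (u i : ℂ) ^ rowDegree a i =
          ((u i : ℂ) ^ 2) ^ (rowDegree a i / 2) * (u i : ℂ) ^ (rowDegree a i % 2) := by
        rw [← pow_mul, ← pow_add, Nat.div_add_mod]
      rw [hN, hd]
      have h3 : s s(i, i) ^ (rowDegree a i / 2) * ((u i : ℂ) ^ 2) ^ (rowDegree a i / 2) = 1 := by
        rw [← mul_pow, hsu, one_pow]
      linear_combination (-(s s(i, i) ^ (N i - rowDegree a i / 2) *
        (u i : ℂ) ^ (rowDegree a i % 2))) * h3
    rw [h1, mul_assoc, h2]
    ring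
  rw [Finset.sum_congr rfl hterm, ← Finset.mul_sum, hτf, mul_zero]

include hG in
/-- The normalized variety consists of the points of `X_G` with ones on the diagonal. -/
lemma image_unitDiag_varietyHat :
    unitDiag '' varietyHat G = variety G ∩ hatSigma n := by
  refine Set.Subset.antisymm ?_ ?_
  · rintro _ ⟨τ, hτ, rfl⟩
    refine ⟨fun f hf => ?_, symMatrix_unitDiag_self τ⟩
    have hrestr : ∀ τ : HatPoint n,
        aeval τ (aeval (unitDiag (X : OffDiag n → MvPolynomial (OffDiag n) ℂ)) f) =
          aeval (unitDiag τ) f := fun τ => by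
      have : (aeval τ).comp (aeval (unitDiag (X : OffDiag n → MvPolynomial (OffDiag n) ℂ))) =
          (aeval (unitDiag τ) : MvPolynomial (Sym2 (Fin n)) ℂ →ₐ[ℂ] ℂ) := by
        refine MvPolynomial.algHom_ext fun e => ?_
        by_cases h : e.IsDiag <;> simp [unitDiag, h]
      rw [← this]; rfl
    rw [← hrestr]
    refine hτ _ fun τ' hτ' => ?_
    rw [hrestr]
    exact hf _ hτ'
  · rintro σ ⟨hσ, hdiag⟩
    have hunit : unitDiag (fun e : OffDiag n => σ e.1) = σ := by
      funext e
      by_cases h : e.IsDiag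
      · induction e with
        | _ i j =>
        obtain rfl : i = j := by simpa using h
        simp [unitDiag, hdiag i]
      · simp [unitDiag, h]
    refine ⟨fun e => σ e.1, fun f hf => ?_, hunit⟩
    rw [← aeval_homogenization_unitDiag, hunit]
    -- The factor ∏ σ_ii takes care of the points of the model with a zero variance, which cannot be
    -- normalized; it is 1 at σ.
    have hmem : homogenization f * ∏ i, X s(i, i) ∈ vanishingIdeal ℂ (loc G) := fun s hs => by
      rw [map_mul, map_prod]
      by_cases h : ∀ i, s s(i, i) ≠ 0
      · rw [aeval_homogenization_eq_zero hG hf hs h, zero_mul]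
      · push Not at h
        obtain ⟨i, hi⟩ := h
        rw [Finset.prod_eq_zero (Finset.mem_univ i) (by rw [aeval_X, hi]), mul_zero]
    have := hσ _ hmem
    rw [map_mul, map_prod] at this
    simpa [fun i => show σ s(i, i) = 1 from hdiag i] using this

end

end GaussianDAG

end

theorem mainTheorem6 {n : ℕ} (G : Digraph (Fin n)) (hG : GaussianDAG.IsAcyclic G) :
    -- the normalized variety is an affine rational irreducible variety of dimension `|E|`
    (AffineVar.IsIrreducibleVariety (GaussianDAG.varietyHat G) ∧
      AffineVar.IsRational (GaussianDAG.varietyHat G) ∧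
      AffineVar.HasDimension (GaussianDAG.varietyHat G) (GaussianDAG.numEdges G)) ∧
    -- it is also the closure of the positive definite part
    GaussianDAG.varietyHat G =
      AffineVar.zariskiClosure (GaussianDAG.locHat G ∩ GaussianDAG.hatPosDef n) ∧
    -- it is the intersection of `X_G` with the matrices that have ones on the diagonal
    GaussianDAG.unitDiag '' GaussianDAG.varietyHat G =
      GaussianDAG.variety G ∩ GaussianDAG.hatSigma n ∧
    -- the zero set of the ideal of imposed relations
    (∃ B : Set (GaussianDAG.HatPoint n), AffineVar.IsZariskiClosed B ∧
      B ⊆ {τ | MvPolynomial.eval τ (GaussianDAG.thetaHat n) = 0} ∧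
      MvPolynomial.zeroLocus ℂ (GaussianDAG.idealHat G) = GaussianDAG.varietyHat G ∪ B) ∧
    -- the vanishing ideal is prime and is the saturation of the ideal of imposed relations
    ((MvPolynomial.vanishingIdeal ℂ (GaussianDAG.varietyHat G)).IsPrime ∧
      MvPolynomial.vanishingIdeal ℂ (GaussianDAG.varietyHat G) =
        AffineVar.saturation (GaussianDAG.idealHat G) (GaussianDAG.thetaHat n)) ∧
    -- smoothness where no principal minor vanishes
    (∀ τ : GaussianDAG.varietyHat G,
      (∀ A : Finset (Fin n),
        GaussianDAG.principalMinor (GaussianDAG.symMatrix (GaussianDAG.unitDiag τ.1)) A ≠ 0) →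
      AffineVar.IsSmoothAtPoint (GaussianDAG.varietyHat G) τ) := by
  refine ⟨⟨GaussianDAG.isIrreducibleVariety_varietyHat hG, GaussianDAG.isRational_varietyHat hG,
      GaussianDAG.hasDimension_varietyHat hG⟩,
    by rw [GaussianDAG.varietyHat, AffineVar.zariskiClosure, AffineVar.zariskiClosure,
      GaussianDAG.vanishingIdeal_locHat hG, GaussianDAG.vanishingIdeal_posDef hG],
    GaussianDAG.image_unitDiag_varietyHat hG,
    ⟨_, ⟨_, rfl⟩, fun τ hτ => ?_, GaussianDAG.zeroLocus_idealHat hG⟩,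
    ⟨GaussianDAG.isPrime_vanishingIdeal hG, GaussianDAG.vanishingIdeal_eq_saturation hG⟩,
    GaussianDAG.isSmoothAtPoint_varietyHat hG⟩
  have := hτ _ (Ideal.mem_sup_right (Ideal.mem_span_singleton_self _))
  rwa [MvPolynomial.aeval_eq_eval] at this
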